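/- Let $M$ be a nonempty compact smooth Riemannian manifold without boundary, of dimension $n \ge 2$, with geodesic distance $d_M$ (set to $\infty$ between points in different components), and let $\alpha \in (0, \tfrac{1}{6n})$. For each $N$, put $\epsilon_N = N^{-\alpha}$ and let $G_N$ be the random geometric graph whose $N$ nodes are sampled independently and uniformly from $M$ (with respect to the normalized Riemannian volume), two distinct nodes $x, y$ being adjacent ($x \sim y$) if and only if $d_M(x,y) < \epsilon_N$. Let $x_N$ be a node of $G_N$ chosen uniformly at random. Then $$\frac{1}{\deg(x_N)} \sum_{y \sim x_N} \frac{\epsilon_N}{d_M(x_N, y)} \;\longrightarrow\; \frac{n}{n-1} \quad \text{in probability as } N \to \infty,$$ that is, for every $\eta > 0$ the probability that the left-hand side differs from $\frac{n}{n-1}$ by more than $\eta$ tends to $0$ as $N \to \infty$ (the average is taken to be $0$ if $x_N$ has no neighbours). -/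

import Mathlib

open Set Filter Topology MeasureTheory ProbabilityTheory
open scoped Bundle Manifold ContDiff ENNReal

noncomputable section

/-! ### Riemannian volume -/

section Volume

variable {n : ℕ} {M : Type*} [TopologicalSpace M] [ChartedSpace (EuclideanSpace ℝ (Fin n)) M]
  [Bundle.RiemannianBundle (fun x : M ↦ TangentSpace (𝓡 n) x)]

/-- The coordinate vector field `∂_i` of the preferred chart at `x`, at the point of `M` with
coordinates `q`: the image of the `i`-th standard basis vector under the derivative of the inverse
of the chart. -/
def coordVector (x : M) (q : EuclideanSpace ℝ (Fin n)) (i : Fin n) :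
    TangentSpace (𝓡 n) ((chartAt (EuclideanSpace ℝ (Fin n)) x).symm q) :=
  mfderiv (𝓡 n) (𝓡 n) (chartAt (EuclideanSpace ℝ (Fin n)) x).symm q
    (EuclideanSpace.single i (1 : ℝ) : EuclideanSpace ℝ (Fin n))

/-- The matrix `g_ij = ⟨∂_i, ∂_j⟩` of the Riemannian metric in the preferred chart at `x`, at the
point with coordinates `q`. -/
def metricMatrix (x : M) (q : EuclideanSpace ℝ (Fin n)) : Matrix (Fin n) (Fin n) ℝ :=
  Matrix.of fun i j ↦ inner ℝ (coordVector x q i) (coordVector x q j)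

/-- The Riemannian volume of the domain of the preferred chart at `x`, extended by `0` outside this
domain: the measure `√(det g) dq₁ ⋯ dqₙ` on the target of the chart, carried over to `M`. -/
def chartVolume [MeasurableSpace M] (x : M) : Measure M :=
  Measure.map (chartAt (EuclideanSpace ℝ (Fin n)) x).symm
    ((volume.restrict (chartAt (EuclideanSpace ℝ (Fin n)) x).target).withDensity
      fun q ↦ ENNReal.ofReal (Real.sqrt (metricMatrix x q).det))

variable (n M) in
/-- The Riemannian volume measure of `M`. By the change of variables formula, the measures
`chartVolume x` and `chartVolume y` agree on the intersection of the two chart domains; the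
Riemannian volume is the measure obtained by gluing them, that is, their supremum. -/
def riemannianVolume [MeasurableSpace M] : Measure M :=
  ⨆ x : M, chartVolume (n := n) x

variable (n M) in
/-- The uniform probability measure on (a compact, nonempty) `M`: the normalized volume. -/
def uniformMeasure [MeasurableSpace M] : Measure M :=
  (riemannianVolume n M univ)⁻¹ • riemannianVolume n M

variable (n M) in
/-- The joint law of `N` independent uniformly distributed points of `M` and of the label of one of
them, chosen uniformly at random from the `N` labels, independently of the points. -/
def randomNodeLaw [MeasurableSpace M] (N : ℕ) : Measure ((Fin N → M) × Fin N) :=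
  (Measure.pi fun _ : Fin N ↦ uniformMeasure n M).prod (uniformOn (univ : Set (Fin N)))

end Volume

/-! ### Random geometric graphs

The distance `d_M` is `edist`; it is infinite between points in distinct components of `M`. -/

section Graph

variable {M : Type*} [EMetricSpace M] {N : ℕ}

/-- The geometric graph with nodes the points `p i` and connectivity threshold `ε`. -/
def geometricGraph (ε : ℝ) (p : Fin N → M) : SimpleGraph (Fin N) where
  Adj i j := i ≠ j ∧ edist (p i) (p j) < ENNReal.ofReal ε
  symm := ⟨fun _ _ h ↦ ⟨h.1.symm, by rw [edist_comm]; exact h.2⟩⟩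
  loopless := ⟨fun _ h ↦ h.1 rfl⟩

open Classical in
/-- The average of `ε / d_M(x, y)` over the neighbours `y` of the node `x = p i` in the geometric
graph with threshold `ε` (and `0` if there is no neighbour). -/
def meanRatio (ε : ℝ) (p : Fin N → M) (i : Fin N) : ℝ :=
  (∑ j ∈ (geometricGraph ε p).neighborFinset i, ε / (edist (p i) (p j)).toReal) /
    ((geometricGraph ε p).degree i : ℝ)

end Graph

/-- Convergence in probability to a constant `c` of random variables `Z N`, the `N`-th one being
defined on its own probability space `(Ω N, P N)`. -/
def ConvergesInProbability {Ω : ℕ → Type*} [∀ N, MeasurableSpace (Ω N)]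
    (P : ∀ N, Measure (Ω N)) (Z : ∀ N, Ω N → ℝ) (c : ℝ) : Prop :=
  ∀ η : ℝ, 0 < η → Tendsto (fun N ↦ P N {s | η < |Z N s - c|}) atTop (𝓝 0)

end

/-!
Conditionally on the position `x` of the random node, the other nodes are independent and uniform.
So it suffices to prove the convergence in probability at each fixed centre `x`, without uniformity;
the integration over `x` is dominated convergence for probabilities. At a fixed centre, the only
geometric input is that the uniform measure `μ` of a ball satisfies `μ (B(x, ρ)) ∼ c ρⁿ` as
`ρ → 0` for some `c > 0`; the value of `c`, and its independence of `x`, are irrelevant because `c`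
cancels in the average.

*Geometry.* The Riemannian volumes of two chart domains agree on the overlap, by the change of
variables formula (`chartVolume_eq_chartVolume`), so near `x` the supremum defining
`riemannianVolume` is the volume `√(det g) dq` in the chart at `x`
(`riemannianVolume_eq_chartVolume`). Since the metric is continuous, the distance to `x` is, up to a
factor tending to `1`, the norm of `T_x M` read in the chart: the lower bound on `d(x, y)` comes
from following an almost minimizing path (`exists_enorm_chartFrame_sub_le`), the upper bound from
the segment in the chart (`exists_edist_le_enorm_chartFrame_sub`). Hence small balls are squeezed
between concentric ellipsoids, whose volumes scale like `ρⁿ`, and the density is nearly constant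
there (`exists_tendsto_riemannianVolume_ball_div_pow`). Compactness then makes the volume finite.

*Probability.* Put `f = ε / d(x, ·)` on `{d(x, ·) < ε}` and `f = 0` elsewhere. By the layer cake
formula,
`ε⁻ⁿ ∫ f dμ = ∫_{s > 0} ε⁻ⁿ μ (B(x, ε / max 1 s)) ds → c ∫_{s > 0} (max 1 s)⁻ⁿ ds = c n / (n - 1)`
(`tendsto_integral_thresholdRatio_div_pow`). In dimension `2` the function `f` has no second moment,
so `f` is truncated before Chebyshev's inequality is applied, and the remainder is controlled by its
mean (`tendsto_measure_pi_lt_abs_sum_div_sub`). With `b = m εⁿ → ∞`, where `m` is the number of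
the other nodes, this shows that the sum of `f` over these nodes, divided by `b`, tends to
`c n / (n - 1)` in probability, and that the number of neighbours divided by `b` tends to `c`; the
quotient of the two is the average in question.
-/

noncomputable section

/-! ### The metric in charts -/

section Frame

variable {n : ℕ} {M : Type*} [TopologicalSpace M] [ChartedSpace (EuclideanSpace ℝ (Fin n)) M]
  [IsManifold (𝓡 n) ∞ M]

variable (n) in
/-- The linear map from the model space `ℝⁿ` to the tangent space at `p` given by the preferred chart
at `x`: the derivative of the inverse chart, an isomorphism, when `p` is in the chart domain, and
zero otherwise. -/
def chartFrame (x p : M) : EuclideanSpace ℝ (Fin n) →L[ℝ] TangentSpace (𝓡 n) p :=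
  (trivializationAt (EuclideanSpace ℝ (Fin n)) (TangentSpace (𝓡 n)) x).symmL ℝ p

variable (n) in
/-- The derivative, at the coordinates of `p`, of the change of charts from the preferred chart at
`x` to the preferred chart at `y`. -/
def chartChange (x y p : M) : EuclideanSpace ℝ (Fin n) →L[ℝ] EuclideanSpace ℝ (Fin n) :=
  (tangentBundleCore (𝓡 n) M).coordChange (achart _ x) (achart _ y) p

theorem chartFrame_eq_mfderiv {x p : M}
    (hp : p ∈ (chartAt (EuclideanSpace ℝ (Fin n)) x).source) :
    chartFrame n x p = mfderiv (𝓡 n) (𝓡 n) (chartAt (EuclideanSpace ℝ (Fin n)) x).symm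
      (chartAt (EuclideanSpace ℝ (Fin n)) x p) := by
  have h := TangentBundle.symmL_trivializationAt (𝕜 := ℝ) (I := 𝓡 n) hp
  rw [chartFrame, h]
  simp [mfld_simps]
  rfl

theorem chartFrame_eq_comp {x y p : M}
    (hx : p ∈ (chartAt (EuclideanSpace ℝ (Fin n)) x).source)
    (hy : p ∈ (chartAt (EuclideanSpace ℝ (Fin n)) y).source) (v : EuclideanSpace ℝ (Fin n)) :
    chartFrame n x p v = chartFrame n y p (chartChange n x y p v) := by
  have h1 := TangentBundle.symmL_trivializationAt_eq_core (𝕜 := ℝ) (I := 𝓡 n) hx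
  have h2 := TangentBundle.symmL_trivializationAt_eq_core (𝕜 := ℝ) (I := 𝓡 n) hy
  rw [chartFrame, chartFrame, h1, h2]
  exact ((tangentBundleCore (𝓡 n) M).coordChange_comp (achart _ x) (achart _ y) (achart _ p) p
    ⟨⟨hx, hy⟩, mem_chart_source _ p⟩ v).symm

theorem hasFDerivAt_chartChange {x y p : M}
    (hx : p ∈ (chartAt (EuclideanSpace ℝ (Fin n)) x).source)
    (hy : p ∈ (chartAt (EuclideanSpace ℝ (Fin n)) y).source) :
    HasFDerivAt (chartAt (EuclideanSpace ℝ (Fin n)) y ∘ (chartAt (EuclideanSpace ℝ (Fin n)) x).symm)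
      (chartChange n x y p) (chartAt (EuclideanSpace ℝ (Fin n)) x p) := by
  have h := contDiffWithinAt_ext_coord_change (I := 𝓡 n) (n := ∞) y x
    (y := extChartAt (𝓡 n) x p) (by
      simp only [ext_coord_change_source]
      refine ⟨chartAt (EuclideanSpace ℝ (Fin n)) x p, ?_, rfl⟩
      simp [hx, hy])
  have h' := (h.differentiableWithinAt (by simp)).hasFDerivWithinAt
  simp only [modelWithCornersSelf_coe, range_id, hasFDerivWithinAt_univ] at h'
  rw [chartChange, tangentBundleCore_coordChange]
  simpa [mfld_simps] using h'

theorem chartFrame_injective {x p : M}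
    (hx : p ∈ (chartAt (EuclideanSpace ℝ (Fin n)) x).source) :
    Function.Injective (chartFrame n x p) := by
  intro v w h
  have := congrArg ((trivializationAt (EuclideanSpace ℝ (Fin n))
    (TangentSpace (𝓡 n)) x).continuousLinearMapAt ℝ p) h
  have hx' : p ∈ (trivializationAt (EuclideanSpace ℝ (Fin n)) (TangentSpace (𝓡 n)) x).baseSet := by
    simpa using hx
  rw [chartFrame, Bundle.Trivialization.continuousLinearMapAt_symmL _ hx'] at this
  rw [Bundle.Trivialization.continuousLinearMapAt_symmL _ hx'] at this
  exact this

theorem continuousAt_chartFrame {x p : M}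
    (hp : p ∈ (chartAt (EuclideanSpace ℝ (Fin n)) x).source) (v : EuclideanSpace ℝ (Fin n)) :
    ContinuousAt (fun y ↦ (⟨y, chartFrame n x y v⟩ :
      Bundle.TotalSpace (EuclideanSpace ℝ (Fin n)) (TangentSpace (𝓡 n)))) p := by
  set e := trivializationAt (EuclideanSpace ℝ (Fin n)) (TangentSpace (𝓡 n)) x
  have hp' : p ∈ e.baseSet := by simpa [e] using hp
  have h1 : ContinuousAt e.toOpenPartialHomeomorph.symm (p, v) :=
    e.toOpenPartialHomeomorph.continuousAt_symm (by simp [e.target_eq, hp'])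
  have h2 : ContinuousAt (fun y : M ↦ (y, v)) p := by fun_prop
  refine (ContinuousAt.comp (f := fun y : M ↦ (y, v)) h1 h2).congr ?_
  filter_upwards [e.open_baseSet.mem_nhds hp'] with y hy
  have := (e.mk_symm hy v).symm
  rw [← e.symmL_apply (R := ℝ) hy v] at this
  exact this

variable [Bundle.RiemannianBundle (fun x : M ↦ TangentSpace (𝓡 n) x)]

omit [IsManifold (𝓡 n) ∞ M] in
theorem inner_tangentSpace_congr {p q : M} (h : p = q) (v w : EuclideanSpace ℝ (Fin n)) :
    @inner ℝ (TangentSpace (𝓡 n) p) _ v w = @inner ℝ (TangentSpace (𝓡 n) q) _ v w := by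
  subst h; rfl

theorem metricMatrix_chart {x p : M} (hp : p ∈ (chartAt (EuclideanSpace ℝ (Fin n)) x).source) :
    metricMatrix x (chartAt (EuclideanSpace ℝ (Fin n)) x p) =
      Matrix.gram ℝ (fun i ↦ chartFrame n x p (EuclideanSpace.single i 1)) := by
  ext i j
  simp only [metricMatrix, Matrix.of_apply, Matrix.gram_apply, coordVector]
  rw [chartFrame_eq_mfderiv hp]
  exact inner_tangentSpace_congr ((chartAt (EuclideanSpace ℝ (Fin n)) x).left_inv hp) _ _

theorem posDef_metricMatrix_chart {x p : M}
    (hp : p ∈ (chartAt (EuclideanSpace ℝ (Fin n)) x).source) :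
    (metricMatrix x (chartAt (EuclideanSpace ℝ (Fin n)) x p)).PosDef := by
  rw [metricMatrix_chart hp]
  apply Matrix.posDef_gram_iff_linearIndependent.2
  have := (EuclideanSpace.basisFun (Fin n) ℝ).toBasis.linearIndependent
  have := this.map' (chartFrame n x p).toLinearMap
    (LinearMap.ker_eq_bot.2 (chartFrame_injective hp))
  have e : (fun i ↦ chartFrame n x p (EuclideanSpace.single i 1)) =
      (chartFrame n x p).toLinearMap ∘ (EuclideanSpace.basisFun (Fin n) ℝ).toBasis := by
    ext1 i; simp
  rw [e]; exact this

/-- The Gram matrices of the metric in two charts are related by `g_x = Dᵀ g_y D`, where `D` is the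
derivative of the change of charts. -/
theorem abs_det_chartChange_mul_sqrt_det_metricMatrix {x y p : M}
    (hx : p ∈ (chartAt (EuclideanSpace ℝ (Fin n)) x).source)
    (hy : p ∈ (chartAt (EuclideanSpace ℝ (Fin n)) y).source) :
    |(chartChange n x y p).det| *
        √(metricMatrix y (chartAt (EuclideanSpace ℝ (Fin n)) y p)).det =
      √(metricMatrix x (chartAt (EuclideanSpace ℝ (Fin n)) x p)).det := by
  set b := (EuclideanSpace.basisFun (Fin n) ℝ).toBasis
  set D := LinearMap.toMatrix b b (chartChange n x y p).toLinearMap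
  have hD : (chartChange n x y p).det = D.det := by
    rw [LinearMap.det_toMatrix]
  have key : metricMatrix x (chartAt (EuclideanSpace ℝ (Fin n)) x p) =
      D.transpose * metricMatrix y (chartAt (EuclideanSpace ℝ (Fin n)) y p) * D := by
    have hv (i : Fin n) : chartFrame n x p (EuclideanSpace.single i 1) =
        ∑ k, D k i • chartFrame n y p (EuclideanSpace.single k 1) := by
      rw [chartFrame_eq_comp hx hy, ← (b.sum_repr (chartChange n x y p (EuclideanSpace.single i 1)))]
      simp [map_sum, D, LinearMap.toMatrix_apply, b]
    rw [metricMatrix_chart hx, metricMatrix_chart hy]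
    ext i j
    simp only [Matrix.gram_apply, hv, sum_inner, inner_sum, inner_smul_left, inner_smul_right,
      Matrix.mul_apply, Matrix.transpose_apply, Finset.sum_mul]
    refine Finset.sum_congr rfl fun k _ ↦ ?_
    rw [Finset.mul_sum]
    refine Finset.sum_congr rfl fun l _ ↦ ?_
    simp only [conj_trivial]
    ring
  rw [key, Matrix.det_mul, Matrix.det_mul, Matrix.det_transpose, hD,
    show D.det * (metricMatrix y (chartAt (EuclideanSpace ℝ (Fin n)) y p)).det * D.det =
      D.det ^ 2 * (metricMatrix y (chartAt (EuclideanSpace ℝ (Fin n)) y p)).det by ring,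
    Real.sqrt_mul (sq_nonneg _), Real.sqrt_sq_eq_abs]

variable [IsContMDiffRiemannianBundle (𝓡 n) ∞ (EuclideanSpace ℝ (Fin n))
      (fun x : M ↦ TangentSpace (𝓡 n) x)]

variable (n M) in
/-- This follows from smoothness of the metric, but is not found by instance search, which cannot
guess the order of smoothness. -/
theorem isContinuousRiemannianBundle_tangentSpace :
    IsContinuousRiemannianBundle (EuclideanSpace ℝ (Fin n))
      (fun x : M ↦ TangentSpace (𝓡 n) x) := by
  obtain ⟨g, hg, h⟩ := IsContMDiffRiemannianBundle.exists_contMDiff (IB := 𝓡 n) (n := ∞)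
    (F := EuclideanSpace ℝ (Fin n)) (E := fun x : M ↦ TangentSpace (𝓡 n) x)
  exact ⟨g, hg.continuous, h⟩

theorem continuousAt_gram {x p : M} (hp : p ∈ (chartAt (EuclideanSpace ℝ (Fin n)) x).source)
    (v w : EuclideanSpace ℝ (Fin n)) :
    ContinuousAt (fun y ↦ inner ℝ (chartFrame n x y v) (chartFrame n x y w)) p := by
  have := isContinuousRiemannianBundle_tangentSpace n M
  exact ContinuousAt.inner_bundle (F := EuclideanSpace ℝ (Fin n)) (b := id)
    (continuousAt_chartFrame hp v) (continuousAt_chartFrame hp w)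

theorem continuousAt_metricMatrix {x p : M}
    (hp : p ∈ (chartAt (EuclideanSpace ℝ (Fin n)) x).source) :
    ContinuousAt (metricMatrix (n := n) x) (chartAt (EuclideanSpace ℝ (Fin n)) x p) := by
  have h1 : ContinuousAt (fun y ↦ Matrix.gram ℝ
      (fun i ↦ chartFrame n x y (EuclideanSpace.single i 1))) p :=
    continuousAt_pi.2 fun i ↦ continuousAt_pi.2 fun j ↦ continuousAt_gram hp _ _
  set φ := chartAt (EuclideanSpace ℝ (Fin n)) x
  have hq : φ p ∈ φ.target := φ.map_source hp
  have h2 : ContinuousAt φ.symm (φ p) := φ.continuousAt_symm hq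
  have h3 : ContinuousAt ((fun y ↦ Matrix.gram ℝ
      (fun i ↦ chartFrame n x y (EuclideanSpace.single i 1))) ∘ φ.symm) (φ p) :=
    ContinuousAt.comp (by rwa [φ.left_inv hp]) h2
  refine h3.congr ?_
  filter_upwards [φ.open_target.mem_nhds hq] with q hq'
  have := metricMatrix_chart (n := n) (φ.map_target hq')
  rw [φ.right_inv hq'] at this
  exact this.symm

end Frame

/-! ### The Riemannian volume in a chart -/

theorem ContinuousOn.measurableSet_preimage_inter {X Y : Type*} [TopologicalSpace X]
    [MeasurableSpace X] [OpensMeasurableSpace X] [TopologicalSpace Y] [MeasurableSpace Y]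
    [BorelSpace Y] {f : X → Y} {s : Set X} (hf : ContinuousOn f s) (hs : MeasurableSet s)
    {A : Set Y} (hA : MeasurableSet A) : MeasurableSet (f ⁻¹' A ∩ s) := by
  have h := hs.subtype_image ((continuousOn_iff_continuous_domRestrict.1 hf).measurable hA)
  convert h using 1
  ext x
  simp [and_comm]

section Volume

variable {n : ℕ} {M : Type*} [TopologicalSpace M] [ChartedSpace (EuclideanSpace ℝ (Fin n)) M]
  [Bundle.RiemannianBundle (fun x : M ↦ TangentSpace (𝓡 n) x)]
  [MeasurableSpace M] [BorelSpace M]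

theorem chartVolume_apply (x : M) {A : Set M} (hA : MeasurableSet A) :
    chartVolume (n := n) x A =
      ∫⁻ q in (chartAt (EuclideanSpace ℝ (Fin n)) x).symm ⁻¹' A ∩
        (chartAt (EuclideanSpace ℝ (Fin n)) x).target,
        ENNReal.ofReal (√(metricMatrix x q).det) := by
  set φ := chartAt (EuclideanSpace ℝ (Fin n)) x
  have hm : AEMeasurable φ.symm (volume.restrict φ.target) :=
    φ.continuousOn_symm.aemeasurable φ.open_target.measurableSet
  rw [chartVolume, Measure.map_apply_of_aemeasurable
    (hm.mono_ac (withDensity_absolutelyContinuous _ _)) hA, withDensity_apply',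
    Measure.restrict_restrict' φ.open_target.measurableSet]

theorem chartVolume_compl_source (x : M) :
    chartVolume (n := n) x (chartAt (EuclideanSpace ℝ (Fin n)) x).sourceᶜ = 0 := by
  set φ := chartAt (EuclideanSpace ℝ (Fin n)) x
  rw [chartVolume_apply x φ.open_source.measurableSet.compl]
  have : φ.symm ⁻¹' φ.sourceᶜ ∩ φ.target = ∅ := by
    ext q
    simp only [mem_inter_iff, mem_preimage, mem_compl_iff, mem_empty_iff_false, iff_false, not_and]
    intro h hq
    exact h (φ.map_target hq)
  rw [this]; simp

variable [IsManifold (𝓡 n) ∞ M]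

/-- The Riemannian volumes of two chart domains agree on the overlap, by the change of variables
formula. -/
theorem chartVolume_eq_chartVolume {x y : M} {A : Set M} (hA : MeasurableSet A)
    (hx : A ⊆ (chartAt (EuclideanSpace ℝ (Fin n)) x).source)
    (hy : A ⊆ (chartAt (EuclideanSpace ℝ (Fin n)) y).source) :
    chartVolume (n := n) x A = chartVolume (n := n) y A := by
  rw [chartVolume_apply x hA, chartVolume_apply y hA]
  set φ := chartAt (EuclideanSpace ℝ (Fin n)) x with hφ
  set ψ := chartAt (EuclideanSpace ℝ (Fin n)) y with hψ
  set S := φ.symm ⁻¹' A ∩ φ.target with hS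
  have hSm : MeasurableSet S :=
    φ.continuousOn_symm.measurableSet_preimage_inter φ.open_target.measurableSet hA
  have himg : ψ.symm ⁻¹' A ∩ ψ.target = (ψ ∘ φ.symm) '' S := by
    ext q
    constructor
    · rintro ⟨h1, h2⟩
      refine ⟨φ (ψ.symm q), ⟨?_, φ.map_source (hx h1)⟩, ?_⟩
      · simpa [φ.left_inv (hx h1)] using h1
      · simp [φ.left_inv (hx h1), ψ.right_inv h2]
    · rintro ⟨q, ⟨h1, h2⟩, rfl⟩
      refine ⟨?_, ψ.map_source (hy h1)⟩
      simpa [ψ.left_inv (hy h1)] using h1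
  have hinj : InjOn (ψ ∘ φ.symm) S := by
    refine ψ.injOn.comp (φ.symm.injOn.mono inter_subset_right) fun q hq ↦ hy hq.1
  rw [himg, lintegral_image_eq_lintegral_abs_det_fderiv_mul volume hSm
    (f' := fun q ↦ chartChange n x y (φ.symm q)) _ hinj]
  · refine setLIntegral_congr_fun hSm fun q hq ↦ ?_
    have h := abs_det_chartChange_mul_sqrt_det_metricMatrix (hx hq.1) (hy hq.1)
    rw [← hφ, φ.right_inv hq.2] at h
    simp only [Function.comp_apply]
    rw [← ENNReal.ofReal_mul (abs_nonneg _), h]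
  · intro q hq
    have h := hasFDerivAt_chartChange (hx hq.1) (hy hq.1)
    rw [← hφ, φ.right_inv hq.2] at h
    exact h.hasFDerivWithinAt

theorem riemannianVolume_eq_chartVolume {x : M} {A : Set M} (hA : MeasurableSet A)
    (hx : A ⊆ (chartAt (EuclideanSpace ℝ (Fin n)) x).source) :
    riemannianVolume n M A = chartVolume (n := n) x A := by
  refine le_antisymm ?_ (le_iSup (fun z : M ↦ chartVolume (n := n) z) x A)
  set U := (chartAt (EuclideanSpace ℝ (Fin n)) x).source with hU
  have hUm : MeasurableSet U := (chartAt (EuclideanSpace ℝ (Fin n)) x).open_source.measurableSet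
  -- a measure that dominates every chart volume and agrees with `chartVolume x` inside `U`
  have hle : riemannianVolume n M ≤ chartVolume (n := n) x + (riemannianVolume n M).restrict Uᶜ := by
    refine iSup_le fun z ↦ Measure.le_iff.2 fun B hB ↦ ?_
    set V := (chartAt (EuclideanSpace ℝ (Fin n)) z).source with hV
    have hVm : MeasurableSet V :=
      (chartAt (EuclideanSpace ℝ (Fin n)) z).open_source.measurableSet
    rw [Measure.add_apply, Measure.restrict_apply hB, ← measure_inter_add_sdiff B hUm]
    refine add_le_add ?_ (le_iSup (fun z : M ↦ chartVolume (n := n) z) z (B \ U))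
    calc chartVolume (n := n) z (B ∩ U)
        ≤ chartVolume (n := n) z (B ∩ U ∩ V) + chartVolume (n := n) z ((B ∩ U) \ V) := by
          rw [measure_inter_add_sdiff _ hVm]
      _ ≤ chartVolume (n := n) z (B ∩ U ∩ V) + chartVolume (n := n) z Vᶜ := by
          gcongr
          exact fun p hp ↦ hp.2
      _ = chartVolume (n := n) x (B ∩ U ∩ V) := by
          rw [chartVolume_compl_source, add_zero]
          exact chartVolume_eq_chartVolume ((hB.inter hUm).inter hVm) inter_subset_right
            (inter_subset_left.trans inter_subset_right)
      _ ≤ chartVolume (n := n) x B := measure_mono (inter_subset_left.trans inter_subset_left)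
  calc riemannianVolume n M A
      ≤ (chartVolume (n := n) x + (riemannianVolume n M).restrict Uᶜ) A := hle A
    _ = chartVolume (n := n) x A := by
      rw [Measure.add_apply, Measure.restrict_apply hA]
      have : A ∩ Uᶜ = ∅ := by
        rw [← sdiff_eq, sdiff_eq_empty]; exact hx
      simp [this]

end Volume

/-! ### The Riemannian distance near a point, read in a chart -/

section Distance

open Manifold

variable {n : ℕ} {M : Type*} [EMetricSpace M] [ChartedSpace (EuclideanSpace ℝ (Fin n)) M]
  [IsManifold (𝓡 n) ∞ M]

variable (n) in
/-- The derivative at `p` of the preferred chart at `x`, for `p` in the chart domain; it is then the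
inverse of `chartFrame n x p`. -/
def chartCoframe (x p : M) : TangentSpace (𝓡 n) p →L[ℝ] EuclideanSpace ℝ (Fin n) :=
  (trivializationAt (EuclideanSpace ℝ (Fin n)) (TangentSpace (𝓡 n)) x).continuousLinearMapAt ℝ p

theorem chartCoframe_eq_mfderiv {x p : M}
    (hp : p ∈ (chartAt (EuclideanSpace ℝ (Fin n)) x).source) :
    chartCoframe n x p = mfderiv (𝓡 n) (𝓡 n) (chartAt (EuclideanSpace ℝ (Fin n)) x) p := by
  have h := TangentBundle.continuousLinearMapAt_trivializationAt (𝕜 := ℝ) (I := 𝓡 n) hp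
  rw [chartCoframe, h]
  rfl

theorem chartCoframe_chartFrame {x p : M}
    (hp : p ∈ (chartAt (EuclideanSpace ℝ (Fin n)) x).source) (v : EuclideanSpace ℝ (Fin n)) :
    chartCoframe n x p (chartFrame n x p v) = v :=
  Bundle.Trivialization.continuousLinearMapAt_symmL _ (by simpa using hp) v

variable [Bundle.RiemannianBundle (fun x : M ↦ TangentSpace (𝓡 n) x)]

theorem exists_norm_le_mul_norm_chartFrame (x : M) :
    ∃ K : ℝ, 0 < K ∧ ∀ v : EuclideanSpace ℝ (Fin n), ‖v‖ ≤ K * ‖chartFrame n x x v‖ := by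
  refine ⟨‖chartCoframe n x x‖ + 1, by positivity, fun v ↦ ?_⟩
  calc ‖v‖ = ‖chartCoframe n x x (chartFrame n x x v)‖ := by
        rw [chartCoframe_chartFrame (mem_chart_source _ x)]
    _ ≤ ‖chartCoframe n x x‖ * ‖chartFrame n x x v‖ := ContinuousLinearMap.le_opNorm _ _
    _ ≤ (‖chartCoframe n x x‖ + 1) * ‖chartFrame n x x v‖ := by gcongr; linarith

variable [IsContMDiffRiemannianBundle (𝓡 n) ∞ (EuclideanSpace ℝ (Fin n))
      (fun x : M ↦ TangentSpace (𝓡 n) x)]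

/-- By continuity of the metric, reading a tangent vector at `y` near `x` in the chart, and measuring
it by the norm at `x`, increases its norm by a factor close to `1` at most. -/
theorem eventually_norm_chartFrame_chartCoframe_le (x : M) {r : ℝ} (hr : 1 < r) :
    ∀ᶠ y in 𝓝 x, ∀ w : TangentSpace (𝓡 n) y,
      ‖chartFrame n x x (chartCoframe n x y w)‖ₑ ≤ ENNReal.ofReal r * ‖w‖ₑ := by
  have := isContinuousRiemannianBundle_tangentSpace n M
  filter_upwards [eventually_norm_symmL_trivializationAt_self_comp_lt (EuclideanSpace ℝ (Fin n))
    (fun x : M ↦ TangentSpace (𝓡 n) x) x hr] with y hy w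
  have h := ContinuousLinearMap.le_of_opNorm_le _ hy.le w
  rw [← ofReal_norm, ← ofReal_norm, ← ENNReal.ofReal_mul (by linarith)]
  exact ENNReal.ofReal_le_ofReal h

/-- By continuity of the metric, the norm at `y` near `x` of a vector given in the chart exceeds its
norm at `x` by a factor close to `1` at most. -/
theorem eventually_norm_chartFrame_le (x : M) {r : ℝ} (hr : 1 < r) :
    ∀ᶠ y in 𝓝 x, ∀ v : EuclideanSpace ℝ (Fin n),
      ‖chartFrame n x y v‖ₑ ≤ ENNReal.ofReal r * ‖chartFrame n x x v‖ₑ := by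
  have := isContinuousRiemannianBundle_tangentSpace n M
  filter_upwards [eventually_norm_symmL_trivializationAt_comp_self_lt (EuclideanSpace ℝ (Fin n))
    (fun x : M ↦ TangentSpace (𝓡 n) x) x hr] with y hy v
  have h := ContinuousLinearMap.le_of_opNorm_le _ hy.le (chartFrame n x x v)
  have h' := chartCoframe_chartFrame (n := n) (mem_chart_source (EuclideanSpace ℝ (Fin n)) x) v
  rw [← ofReal_norm, ← ofReal_norm, ← ENNReal.ofReal_mul (by linarith)]
  refine ENNReal.ofReal_le_ofReal (le_trans (le_of_eq ?_) h)
  conv_lhs => rw [← h']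
  rfl

variable [IsRiemannianManifold (𝓡 n) M]

/-- A path from `x` to a point at distance less than `ρ` that is almost minimizing does not leave
the ball of radius `ρ`, where the metric is almost constant; so the coordinates of its endpoint,
measured by the norm at `x`, are not much further than its length. -/
theorem exists_enorm_chartFrame_sub_le (x : M) {r : ℝ} (hr : 1 < r) :
    ∃ ρ > 0, ∀ y, edist x y < ρ → y ∈ (chartAt (EuclideanSpace ℝ (Fin n)) x).source ∧
      ‖chartFrame n x x (chartAt (EuclideanSpace ℝ (Fin n)) x y -
        chartAt (EuclideanSpace ℝ (Fin n)) x x)‖ₑ ≤ ENNReal.ofReal r * edist x y := by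
  set φ := chartAt (EuclideanSpace ℝ (Fin n)) x with hφ
  obtain ⟨ρ, hρ, hsub⟩ := EMetric.mem_nhds_iff.1 (inter_mem
    (chart_source_mem_nhds (EuclideanSpace ℝ (Fin n)) x)
    (eventually_norm_chartFrame_chartCoframe_le (n := n) x hr))
  have hU : ∀ y, edist x y < ρ → y ∈ φ.source ∧ ∀ w : TangentSpace (𝓡 n) y,
      ‖chartFrame n x x (chartCoframe n x y w)‖ₑ ≤ ENNReal.ofReal r * ‖w‖ₑ :=
    fun y hy ↦ hsub (by simpa [edist_comm] using hy)
  refine ⟨ρ, hρ, fun y hy ↦ ⟨(hU y hy).1, ?_⟩⟩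
  rw [IsRiemannianManifold.out (I := 𝓡 n)] at hy ⊢
  -- follow a path of length less than `s`, where `s` is any number slightly larger than `d(x, y)`
  have key : ∀ s, riemannianEDist (𝓡 n) x y < s → s < ρ →
      ‖chartFrame n x x (φ y - φ x)‖ₑ ≤ ENNReal.ofReal r * s := by
    intro s hs hsρ
    obtain ⟨γ, hγ0, hγ1, hγ, hlen⟩ := exists_lt_of_riemannianEDist_lt hs
    have hmem : ∀ t ∈ Icc (0 : ℝ) 1, γ t ∈ φ.source ∧ ∀ w : TangentSpace (𝓡 n) (γ t),
        ‖chartFrame n x x (chartCoframe n x (γ t) w)‖ₑ ≤ ENNReal.ofReal r * ‖w‖ₑ := by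
      intro t ht
      refine hU _ ?_
      rw [IsRiemannianManifold.out (I := 𝓡 n)]
      calc riemannianEDist (𝓡 n) x (γ t) ≤ pathELength (𝓡 n) γ 0 t :=
            riemannianEDist_le_pathELength (hγ.mono (Icc_subset_Icc le_rfl ht.2)) hγ0 rfl ht.1
        _ ≤ pathELength (𝓡 n) γ 0 1 := pathELength_mono le_rfl ht.2
        _ < ρ := hlen.trans hsρ
    have hc : ContMDiffOn 𝓘(ℝ, ℝ) (𝓡 n) 1 (φ ∘ γ) (Icc 0 1) :=
      (contMDiffOn_chart (I := 𝓡 n) (n := 1) (x := x)).comp hγ fun t ht ↦ (hmem t ht).1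
    have hc' : ContDiffOn ℝ 1 (φ ∘ γ) (Icc 0 1) := contMDiffOn_iff_contDiffOn.1 hc
    have hLc : ContDiffOn ℝ 1 (fun t ↦ chartFrame n x x ((φ ∘ γ) t)) (Icc 0 1) :=
      (chartFrame n x x).contDiff.comp_contDiffOn hc'
    have h1 := enorm_sub_le_lintegral_derivWithin_Icc_of_contDiffOn_Icc hLc zero_le_one
    simp only [Function.comp_apply, hγ0, hγ1, ← map_sub] at h1
    refine h1.trans ?_
    calc _ ≤ ∫⁻ t in Icc (0 : ℝ) 1, ENNReal.ofReal r *
          ‖mfderivWithin 𝓘(ℝ, ℝ) (𝓡 n) γ (Icc 0 1) t 1‖ₑ := by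
          refine setLIntegral_mono' measurableSet_Icc fun t ht ↦ ?_
          have hut : UniqueDiffWithinAt ℝ (Icc (0 : ℝ) 1) t := uniqueDiffOn_Icc zero_lt_one t ht
          have hd : HasDerivWithinAt (φ ∘ γ) (derivWithin (φ ∘ γ) (Icc 0 1) t) (Icc 0 1) t :=
            (hc'.differentiableOn one_ne_zero t ht).hasDerivWithinAt
          have hd' := ((chartFrame n x x).hasFDerivAt.comp_hasDerivWithinAt t hd).derivWithin hut
          have e1 : derivWithin (φ ∘ γ) (Icc 0 1) t = chartCoframe n x (γ t)
              (mfderivWithin 𝓘(ℝ, ℝ) (𝓡 n) γ (Icc 0 1) t 1) := by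
            rw [chartCoframe_eq_mfderiv (hmem t ht).1]
            have := mfderiv_comp_mfderivWithin t (I := 𝓘(ℝ, ℝ)) (I' := 𝓡 n) (I'' := 𝓡 n)
              (f := γ) (g := φ) (s := Icc 0 1)
              ((contMDiffOn_chart (I := 𝓡 n) (n := 1) (x := x)).mdifferentiableOn one_ne_zero
                |>.mdifferentiableAt (φ.open_source.mem_nhds (hmem t ht).1))
              (hγ.mdifferentiableOn one_ne_zero t ht)
              (uniqueMDiffWithinAt_iff_uniqueDiffWithinAt.2 hut)
            rw [mfderivWithin_eq_fderivWithin] at this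
            rw [← fderivWithin_derivWithin]
            exact congrArg (fun F ↦ F 1) this
          refine le_trans (le_of_eq ?_) ((hmem t ht).2 _)
          rw [← e1]
          exact congrArg _ hd'
      _ = ENNReal.ofReal r * pathELength (𝓡 n) γ 0 1 := by
          rw [lintegral_const_mul' _ _ ENNReal.ofReal_ne_top,
            pathELength_eq_lintegral_mfderivWithin_Icc]
      _ ≤ ENNReal.ofReal r * s := by gcongr
  have hr0 : ENNReal.ofReal r ≠ 0 := (ENNReal.ofReal_pos.2 (by linarith)).ne'
  by_contra! hlt
  rw [mul_comm, ← ENNReal.lt_div_iff_mul_lt (Or.inl hr0) (Or.inl ENNReal.ofReal_ne_top)] at hlt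
  obtain ⟨s, hs, hs'⟩ := exists_between (lt_min hy hlt)
  refine absurd (key s hs (hs'.trans_le (min_le_left _ _))) (not_le.2 ?_)
  rw [mul_comm, ← ENNReal.lt_div_iff_mul_lt (Or.inl hr0) (Or.inl ENNReal.ofReal_ne_top)]
  exact hs'.trans_le (min_le_right _ _)

/-- The path whose image in the chart at `x` is a segment issued from `x` is almost minimizing: its
length is bounded by the length of the segment for the norm at `x`, up to a factor close to `1`. -/
theorem exists_edist_le_enorm_chartFrame_sub (x : M) {r : ℝ} (hr : 1 < r) :
    ∃ ρ : ℝ, 0 < ρ ∧ ∀ q, ‖chartFrame n x x (q - chartAt (EuclideanSpace ℝ (Fin n)) x x)‖ < ρ →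
      q ∈ (chartAt (EuclideanSpace ℝ (Fin n)) x).target ∧
      edist x ((chartAt (EuclideanSpace ℝ (Fin n)) x).symm q) ≤ ENNReal.ofReal r *
      ‖chartFrame n x x (q - chartAt (EuclideanSpace ℝ (Fin n)) x x)‖ₑ := by
  set φ := chartAt (EuclideanSpace ℝ (Fin n)) x with hφ
  have hx : x ∈ φ.source := mem_chart_source _ x
  set T : Set (EuclideanSpace ℝ (Fin n)) := {q | q ∈ φ.target ∧ ∀ v : EuclideanSpace ℝ (Fin n),
      ‖chartFrame n x (φ.symm q) v‖ₑ ≤ ENNReal.ofReal r * ‖chartFrame n x x v‖ₑ} with hT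
  have hTn : T ∈ 𝓝 (φ x) := by
    have h1 := φ.continuousAt_symm (φ.map_source hx)
    rw [ContinuousAt, φ.left_inv hx] at h1
    filter_upwards [φ.open_target.mem_nhds (φ.map_source hx),
      h1.eventually (eventually_norm_chartFrame_le (n := n) x hr)] with q h2 h3
    exact ⟨h2, h3⟩
  obtain ⟨δ, hδ, hδT⟩ := Metric.mem_nhds_iff.1 hTn
  obtain ⟨K, hKpos, hbound⟩ := exists_norm_le_mul_norm_chartFrame (n := n) x
  have hballT : ∀ q, ‖chartFrame n x x (q - φ x)‖ < δ / K → q ∈ T := by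
    intro q hq
    apply hδT
    rw [mem_ball_iff_norm]
    calc _ ≤ K * ‖chartFrame n x x (q - φ x)‖ := hbound _
      _ < K * (δ / K) := by gcongr
      _ = δ := by field_simp
  refine ⟨δ / K, by positivity, fun q hq ↦ ⟨(hballT q hq).1, ?_⟩⟩
  set v := q - φ x with hv
  set η : ℝ → EuclideanSpace ℝ (Fin n) := fun t ↦ φ x + t • v with hη
  have hηT : ∀ t ∈ Icc (0 : ℝ) 1, η t ∈ T := by
    intro t ht
    refine hballT _ (lt_of_le_of_lt ?_ hq)
    simp only [hη, add_sub_cancel_left, map_smul, norm_smul, Real.norm_eq_abs, abs_of_nonneg ht.1]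
    exact mul_le_of_le_one_left (norm_nonneg _) ht.2
  have hηd : ∀ t, HasDerivAt η v t := fun t ↦ by
    simpa [hη] using ((hasDerivAt_id t).smul_const v).const_add (φ x)
  have hηs : ContMDiffOn 𝓘(ℝ, ℝ) (𝓡 n) 1 η (Icc 0 1) := by
    apply ContMDiff.contMDiffOn
    rw [contMDiff_iff_contDiff]
    fun_prop
  have hγ : ContMDiffOn 𝓘(ℝ, ℝ) (𝓡 n) 1 (φ.symm ∘ η) (Icc 0 1) :=
    (contMDiffOn_chart_symm (I := 𝓡 n) (n := 1) (x := x)).comp hηs fun t ht ↦ (hηT t ht).1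
  rw [IsRiemannianManifold.out (I := 𝓡 n)]
  refine (riemannianEDist_le_pathELength hγ (by simp [hη, φ.left_inv hx]) (by simp [hη, hv])
    zero_le_one).trans ?_
  rw [pathELength_eq_lintegral_mfderivWithin_Icc]
  calc _ ≤ ∫⁻ t in Icc (0 : ℝ) 1, ENNReal.ofReal r * ‖chartFrame n x x v‖ₑ := by
        refine setLIntegral_mono' measurableSet_Icc fun t ht ↦ ?_
        have hut : UniqueDiffWithinAt ℝ (Icc (0 : ℝ) 1) t := uniqueDiffOn_Icc zero_lt_one t ht
        have hmem := hηT t ht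
        have e1 : mfderivWithin 𝓘(ℝ, ℝ) (𝓡 n) (φ.symm ∘ η) (Icc 0 1) t 1 =
            chartFrame n x (φ.symm (η t)) v := by
          rw [chartFrame_eq_mfderiv (φ.map_target hmem.1)]
          have := mfderiv_comp_mfderivWithin t (I := 𝓘(ℝ, ℝ)) (I' := 𝓡 n) (I'' := 𝓡 n)
            (f := η) (g := φ.symm) (s := Icc 0 1)
            ((contMDiffOn_chart_symm (I := 𝓡 n) (n := 1) (x := x)).mdifferentiableOn one_ne_zero
              |>.mdifferentiableAt (φ.open_target.mem_nhds hmem.1))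
            (hηs.mdifferentiableOn one_ne_zero t ht)
            (uniqueMDiffWithinAt_iff_uniqueDiffWithinAt.2 hut)
          rw [this, mfderivWithin_eq_fderivWithin,
            (hηd t).hasDerivWithinAt.hasFDerivWithinAt.fderivWithin hut, ← hφ,
            φ.right_inv hmem.1]
          exact congrArg (mfderiv (𝓡 n) (𝓡 n) φ.symm (η t)) (one_smul ℝ v)
        exact (le_of_eq (congrArg _ e1)).trans (hmem.2 v)
    _ = ENNReal.ofReal r * ‖chartFrame n x x v‖ₑ := by simp

end Distance

/-! ### Volumes of small balls -/

/-- To prove that `f` tends to `c`, it suffices to squeeze it between `c / r ^ k` and `c * r ^ k` for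
each `r > 1`. -/
theorem tendsto_of_eventually_mem_Icc_div_mul_pow {ι : Type*} {l : Filter ι} {f : ι → ℝ} {c : ℝ}
    (k : ℕ) (h : ∀ r : ℝ, 1 < r → ∀ᶠ t in l, c / r ^ k ≤ f t ∧ f t ≤ c * r ^ k) :
    Tendsto f l (𝓝 c) := by
  have h1 : Tendsto (fun r : ℝ ↦ c / r ^ k) (𝓝[>] 1) (𝓝 c) := by
    have : ContinuousAt (fun r : ℝ ↦ c / r ^ k) 1 := by
      apply ContinuousAt.div (by fun_prop) (by fun_prop) (by simp)
    simpa [ContinuousAt] using this.tendsto.mono_left nhdsWithin_le_nhds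
  have h2 : Tendsto (fun r : ℝ ↦ c * r ^ k) (𝓝[>] 1) (𝓝 c) := by
    have : ContinuousAt (fun r : ℝ ↦ c * r ^ k) 1 := by fun_prop
    simpa [ContinuousAt] using this.tendsto.mono_left nhdsWithin_le_nhds
  refine tendsto_order.2 ⟨fun a ha ↦ ?_, fun b hb ↦ ?_⟩
  · obtain ⟨r, hr, hr'⟩ := (((tendsto_order.1 h1).1 a ha).and self_mem_nhdsWithin).exists
    filter_upwards [h r hr'] with t ht using hr.trans_le ht.1
  · obtain ⟨r, hr, hr'⟩ := (((tendsto_order.1 h2).2 b hb).and self_mem_nhdsWithin).exists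
    filter_upwards [h r hr'] with t ht using ht.2.trans_lt hr

section SmallBalls

open scoped Pointwise

variable {n : ℕ} {M : Type*} [EMetricSpace M] [ChartedSpace (EuclideanSpace ℝ (Fin n)) M]
  [IsManifold (𝓡 n) ∞ M] [Bundle.RiemannianBundle (fun x : M ↦ TangentSpace (𝓡 n) x)]

variable (n) in
/-- The ellipsoid of radius `s` around the coordinates of `x` in the preferred chart at `x`: the
ball for the norm of the tangent space at `x`, read in the chart. -/
def chartEllipsoid (x : M) (s : ℝ) : Set (EuclideanSpace ℝ (Fin n)) :=
  {q | ‖chartFrame n x x (q - chartAt (EuclideanSpace ℝ (Fin n)) x x)‖ < s}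

theorem measurableSet_chartEllipsoid (x : M) (s : ℝ) : MeasurableSet (chartEllipsoid n x s) := by
  apply IsOpen.measurableSet
  apply isOpen_lt _ continuous_const
  exact continuous_norm.comp ((chartFrame n x x).continuous.comp (by fun_prop))

theorem volume_chartEllipsoid (x : M) {s : ℝ} (hs : 0 < s) :
    volume (chartEllipsoid n x s) = ENNReal.ofReal (s ^ n) * volume (chartEllipsoid n x 1) := by
  have key : ∀ {s : ℝ}, 0 < s → volume (chartEllipsoid n x s) = ENNReal.ofReal (s ^ n) *
      volume {v : EuclideanSpace ℝ (Fin n) | ‖chartFrame n x x v‖ < 1} := by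
    intro s hs
    have h1 : chartEllipsoid n x s = (fun q ↦ q - chartAt (EuclideanSpace ℝ (Fin n)) x x) ⁻¹'
        (s • {v : EuclideanSpace ℝ (Fin n) | ‖chartFrame n x x v‖ < 1}) := by
      ext q
      rw [mem_preimage, mem_smul_set_iff_inv_smul_mem₀ hs.ne']
      simp only [chartEllipsoid, mem_ofPred_eq, map_smul, norm_smul, norm_inv, Real.norm_eq_abs,
        abs_of_pos hs]
      rw [inv_mul_lt_iff₀ hs, mul_one]
    simp only [sub_eq_add_neg] at h1
    rw [h1, measure_preimage_add_right, Measure.addHaar_smul]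
    simp [abs_of_pos hs]
  rw [key hs, key one_pos]
  simp

theorem volume_chartEllipsoid_pos (x : M) : 0 < volume (chartEllipsoid n x 1) := by
  refine IsOpen.measure_pos _ ?_ ⟨chartAt (EuclideanSpace ℝ (Fin n)) x x, by simp [chartEllipsoid]⟩
  apply isOpen_lt _ continuous_const
  exact continuous_norm.comp ((chartFrame n x x).continuous.comp (by fun_prop))

theorem exists_chartEllipsoid_subset_ball (x : M) : ∃ K : ℝ, 0 < K ∧ ∀ s,
    chartEllipsoid n x s ⊆ Metric.ball (chartAt (EuclideanSpace ℝ (Fin n)) x x) (K * s) := by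
  obtain ⟨K, hK, h⟩ := exists_norm_le_mul_norm_chartFrame (n := n) x
  refine ⟨K, hK, fun s q hq ↦ ?_⟩
  rw [mem_ball_iff_norm]
  exact (h _).trans_lt (mul_lt_mul_of_pos_left hq hK)

theorem volume_chartEllipsoid_lt_top (x : M) : volume (chartEllipsoid n x 1) < ⊤ := by
  obtain ⟨K, -, h⟩ := exists_chartEllipsoid_subset_ball (n := n) x
  exact (measure_mono (h 1)).trans_lt measure_ball_lt_top

theorem eventually_chartEllipsoid_subset (x : M) {U : Set (EuclideanSpace ℝ (Fin n))}
    (hU : U ∈ 𝓝 (chartAt (EuclideanSpace ℝ (Fin n)) x x)) :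
    ∀ᶠ s in 𝓝 (0 : ℝ), chartEllipsoid n x s ⊆ U := by
  obtain ⟨K, hK, h⟩ := exists_chartEllipsoid_subset_ball (n := n) x
  obtain ⟨δ, hδ, hδU⟩ := Metric.mem_nhds_iff.1 hU
  filter_upwards [gt_mem_nhds (show 0 < δ / K by positivity)] with s hs
  refine (h s).trans ((Metric.ball_subset_ball ?_).trans hδU)
  rw [mul_comm]
  exact ((lt_div_iff₀ hK).1 hs).le

variable [IsContMDiffRiemannianBundle (𝓡 n) ∞ (EuclideanSpace ℝ (Fin n))
      (fun x : M ↦ TangentSpace (𝓡 n) x)]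
  [IsRiemannianManifold (𝓡 n) M]

/-- Small balls, read in the chart, are squeezed between two ellipsoids. -/
theorem eventually_chartEllipsoid_subset_preimage_ball (x : M) {r : ℝ} (hr : 1 < r) :
    ∀ᶠ ρ in 𝓝[>] (0 : ℝ),
      {y | edist x y < ENNReal.ofReal ρ} ⊆ (chartAt (EuclideanSpace ℝ (Fin n)) x).source ∧
      chartEllipsoid n x (ρ / r) ⊆ (chartAt (EuclideanSpace ℝ (Fin n)) x).symm ⁻¹'
        {y | edist x y < ENNReal.ofReal ρ} ∩ (chartAt (EuclideanSpace ℝ (Fin n)) x).target ∧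
      (chartAt (EuclideanSpace ℝ (Fin n)) x).symm ⁻¹' {y | edist x y < ENNReal.ofReal ρ} ∩
        (chartAt (EuclideanSpace ℝ (Fin n)) x).target ⊆ chartEllipsoid n x (ρ * r) := by
  have hr0 : 0 < r := one_pos.trans hr
  obtain ⟨ρ₁, hρ₁, h₁⟩ := exists_enorm_chartFrame_sub_le (n := n) x hr
  obtain ⟨ρ₂, hρ₂, h₂⟩ := exists_edist_le_enorm_chartFrame_sub (n := n) x hr
  have e₁ : ∀ᶠ ρ in 𝓝[>] (0 : ℝ), ENNReal.ofReal ρ < ρ₁ := by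
    have : Tendsto ENNReal.ofReal (𝓝[>] (0 : ℝ)) (𝓝 0) := by
      simpa using (ENNReal.continuous_ofReal.tendsto 0).mono_left nhdsWithin_le_nhds
    exact this.eventually (gt_mem_nhds hρ₁)
  have e₂ : ∀ᶠ ρ in 𝓝[>] (0 : ℝ), ρ < ρ₂ := nhdsWithin_le_nhds (gt_mem_nhds hρ₂)
  filter_upwards [e₁, e₂, self_mem_nhdsWithin] with ρ hρ hρ' hpos
  have hpos : 0 < ρ := hpos
  refine ⟨fun y hy ↦ (h₁ y (lt_trans hy hρ)).1, fun q hq ↦ ?_, fun q hq ↦ ?_⟩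
  · have hq' : ‖chartFrame n x x (q - chartAt (EuclideanSpace ℝ (Fin n)) x x)‖ < ρ / r := hq
    obtain ⟨h3, h4⟩ := h₂ q (hq'.trans ((div_le_self hpos.le hr.le).trans_lt hρ'))
    refine ⟨h4.trans_lt ?_, h3⟩
    rw [← ofReal_norm, ← ENNReal.ofReal_mul hr0.le, ENNReal.ofReal_lt_ofReal_iff hpos]
    rw [lt_div_iff₀ hr0] at hq'
    linarith
  · have h3 := (h₁ _ (lt_trans hq.1 hρ)).2
    rw [(chartAt (EuclideanSpace ℝ (Fin n)) x).right_inv hq.2] at h3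
    have h4 := h3.trans_lt (ENNReal.mul_lt_mul_right (ENNReal.ofReal_pos.2 hr0).ne'
      ENNReal.ofReal_ne_top hq.1)
    rw [← ofReal_norm, ← ENNReal.ofReal_mul hr0.le, ENNReal.ofReal_lt_ofReal_iff (by positivity),
      mul_comm] at h4
    exact h4

variable [MeasurableSpace M] [BorelSpace M]

/-- The volume of a ball of radius `ρ` around `x` is asymptotic to `c ρⁿ` as `ρ` tends to `0`, for
some positive constant `c`. -/
theorem exists_tendsto_riemannianVolume_ball_div_pow (x : M) :
    ∃ c : ℝ, 0 < c ∧ Tendsto (fun ρ : ℝ ↦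
      (riemannianVolume n M).real {y | edist x y < ENNReal.ofReal ρ} / ρ ^ n) (𝓝[>] 0) (𝓝 c) := by
  set φ := chartAt (EuclideanSpace ℝ (Fin n)) x with hφ
  have hx : x ∈ φ.source := mem_chart_source _ x
  set d : EuclideanSpace ℝ (Fin n) → ℝ := fun q ↦ √(metricMatrix x q).det with hd
  have hd0 : 0 < d (φ x) := Real.sqrt_pos.2 (posDef_metricMatrix_chart hx).det_pos
  have hdc : ContinuousAt d (φ x) :=
    ((continuous_id.matrix_det).continuousAt.comp (continuousAt_metricMatrix hx)).sqrt
  set w := volume (chartEllipsoid n x 1) with hw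
  have hw0 : 0 < w.toReal :=
    ENNReal.toReal_pos (volume_chartEllipsoid_pos x).ne' (volume_chartEllipsoid_lt_top x).ne
  refine ⟨d (φ x) * w.toReal, by positivity, ?_⟩
  refine tendsto_of_eventually_mem_Icc_div_mul_pow (n + 1) fun r hr ↦ ?_
  have hr0 : 0 < r := one_pos.trans hr
  have hnhds : {q | d (φ x) / r ≤ d q ∧ d q ≤ d (φ x) * r} ∈ 𝓝 (φ x) := by
    filter_upwards [hdc.eventually (lt_mem_nhds (div_lt_self hd0 hr)),
      hdc.eventually (gt_mem_nhds (lt_mul_of_one_lt_right hd0 hr))] with q h1 h2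
    exact ⟨h1.le, h2.le⟩
  have hE : ∀ᶠ ρ in 𝓝[>] (0 : ℝ),
      chartEllipsoid n x (ρ * r) ⊆ {q | d (φ x) / r ≤ d q ∧ d q ≤ d (φ x) * r} := by
    have : Tendsto (fun ρ : ℝ ↦ ρ * r) (𝓝[>] 0) (𝓝 0) := by
      have := (continuous_mul_const r).tendsto 0
      rw [zero_mul] at this
      exact this.mono_left nhdsWithin_le_nhds
    exact this.eventually (eventually_chartEllipsoid_subset x hnhds)
  filter_upwards [hE, eventually_chartEllipsoid_subset_preimage_ball (n := n) x hr,
    self_mem_nhdsWithin] with ρ hρ ⟨hB, hlow, hup⟩ hpos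
  have hpos : 0 < ρ := hpos
  set B := {y | edist x y < ENNReal.ofReal ρ} with hBdef
  have hBm : MeasurableSet B := by
    apply IsOpen.measurableSet
    exact isOpen_lt (by fun_prop) continuous_const
  have hvol := riemannianVolume_eq_chartVolume (n := n) hBm hB
  rw [chartVolume_apply x hBm] at hvol
  have hU : riemannianVolume n M B ≤ ENNReal.ofReal (d (φ x) * r * (ρ * r) ^ n) * w := by
    rw [hvol, ENNReal.ofReal_mul (by positivity), mul_assoc, hw,
      ← volume_chartEllipsoid x (by positivity), ← setLIntegral_const]
    refine (lintegral_mono_set hup).trans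
      (setLIntegral_mono' (measurableSet_chartEllipsoid x _) fun q hq ↦ ?_)
    exact ENNReal.ofReal_le_ofReal (hρ hq).2
  have hL : ENNReal.ofReal (d (φ x) / r * (ρ / r) ^ n) * w ≤ riemannianVolume n M B := by
    rw [hvol, ENNReal.ofReal_mul (by positivity), mul_assoc, hw,
      ← volume_chartEllipsoid x (by positivity), ← setLIntegral_const]
    refine le_trans (setLIntegral_mono' (measurableSet_chartEllipsoid x _) fun q hq ↦ ?_)
      (lintegral_mono_set hlow)
    exact ENNReal.ofReal_le_ofReal (hρ (hup (hlow hq))).1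
  have hwtop : w ≠ ⊤ := (volume_chartEllipsoid_lt_top x).ne
  have hUtop : ENNReal.ofReal (d (φ x) * r * (ρ * r) ^ n) * w ≠ ⊤ :=
    ENNReal.mul_ne_top ENNReal.ofReal_ne_top hwtop
  have hU' := ENNReal.toReal_mono hUtop hU
  have hL' := ENNReal.toReal_mono (ne_top_of_le_ne_top hUtop hU) hL
  rw [ENNReal.toReal_mul, ENNReal.toReal_ofReal (by positivity)] at hU' hL'
  rw [le_div_iff₀ (by positivity), div_le_iff₀ (by positivity)]
  constructor
  · refine le_trans (le_of_eq ?_) hL'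
    rw [div_pow, pow_succ]
    field_simp
  · refine hU'.trans (le_of_eq ?_)
    rw [mul_pow]; ring

variable (n M) in
theorem isFiniteMeasure_riemannianVolume [CompactSpace M] :
    IsFiniteMeasure (riemannianVolume n M) := by
  have : IsLocallyFiniteMeasure (riemannianVolume n M) := by
    refine ⟨fun x ↦ ?_⟩
    obtain ⟨c, hc, h⟩ := exists_tendsto_riemannianVolume_ball_div_pow (n := n) x
    obtain ⟨ρ, hρ, hpos⟩ := ((h.eventually (lt_mem_nhds hc)).and self_mem_nhdsWithin).exists
    have hpos : 0 < ρ := hpos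
    refine ⟨{y | edist x y < ENNReal.ofReal ρ}, ?_, ?_⟩
    · filter_upwards [Metric.eball_mem_nhds x (ENNReal.ofReal_pos.2 hpos)] with y hy
      simpa [edist_comm] using hy
    · -- an infinite measure would have the junk real value `0`
      rw [lt_top_iff_ne_top]
      intro htop
      simp [Measure.real, htop] at hρ
  infer_instance

variable (n M) in
theorem isProbabilityMeasure_uniformMeasure [CompactSpace M] [Nonempty M] :
    IsProbabilityMeasure (uniformMeasure n M) := by
  have := isFiniteMeasure_riemannianVolume n M
  have : NeZero (riemannianVolume n M) := by
    refine ⟨fun h0 ↦ ?_⟩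
    obtain ⟨c, hc, h⟩ := exists_tendsto_riemannianVolume_ball_div_pow (n := n)
      (Classical.arbitrary M)
    simp only [h0, measureReal_zero_apply, zero_div] at h
    exact hc.ne (tendsto_nhds_unique tendsto_const_nhds h)
  exact isProbabilityMeasureSMul

/-- The probability that a uniform random point falls at distance less than `ρ` from `x` is
asymptotic to `c ρⁿ` as `ρ` tends to `0`, for some positive constant `c`. -/
theorem exists_tendsto_uniformMeasure_ball_div_pow [CompactSpace M] (x : M) :
    ∃ c : ℝ, 0 < c ∧ Tendsto (fun ρ : ℝ ↦
      (uniformMeasure n M).real {y | edist x y < ENNReal.ofReal ρ} / ρ ^ n) (𝓝[>] 0) (𝓝 c) := by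
  have : Nonempty M := ⟨x⟩
  have := isProbabilityMeasure_uniformMeasure n M
  obtain ⟨c, hc, h⟩ := exists_tendsto_riemannianVolume_ball_div_pow (n := n) x
  have hne : (riemannianVolume n M univ)⁻¹ ≠ 0 := by
    intro h0
    have h1 := measure_univ (μ := uniformMeasure n M)
    simp [uniformMeasure, h0] at h1
  have hne' : (riemannianVolume n M univ)⁻¹ ≠ ⊤ := by
    intro h0
    have h1 := measure_univ (μ := uniformMeasure n M)
    rw [ENNReal.inv_eq_top] at h0
    simp [uniformMeasure, h0] at h1
  refine ⟨((riemannianVolume n M univ)⁻¹).toReal * c, mul_pos (ENNReal.toReal_pos hne hne') hc, ?_⟩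
  simpa only [uniformMeasure, measureReal_ennreal_smul_apply, mul_div_assoc] using h.const_mul _

end SmallBalls

/-! ### The mean of the truncated inverse distance -/

section FirstMoment

theorem integrableOn_inv_max_one_pow {n : ℕ} (hn : 2 ≤ n) :
    IntegrableOn (fun s : ℝ ↦ ((max 1 s) ^ n)⁻¹) (Ioi 0) ∧
      ∫ s in Ioi (0 : ℝ), ((max 1 s) ^ n)⁻¹ = n / (n - 1) := by
  have hn' : (2 : ℝ) ≤ n := by exact_mod_cast hn
  have e1 : EqOn (fun s : ℝ ↦ ((max 1 s) ^ n)⁻¹) (fun _ ↦ 1) (Ioc 0 1) := by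
    intro s hs; simp [max_eq_left hs.2]
  have e2 : EqOn (fun s : ℝ ↦ ((max 1 s) ^ n)⁻¹) (fun s ↦ s ^ (-(n : ℝ))) (Ioi 1) := by
    intro s hs
    have hs : 1 < s := hs
    simp only [max_eq_right hs.le]
    rw [Real.rpow_neg (by linarith), Real.rpow_natCast]
  have i1 : IntegrableOn (fun s : ℝ ↦ ((max 1 s) ^ n)⁻¹) (Ioc 0 1) := by
    rw [integrableOn_congr_fun e1 measurableSet_Ioc]
    simp
  have i2 : IntegrableOn (fun s : ℝ ↦ ((max 1 s) ^ n)⁻¹) (Ioi 1) := by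
    rw [integrableOn_congr_fun e2 measurableSet_Ioi]
    exact integrableOn_Ioi_rpow_of_lt (by linarith) one_pos
  rw [← Ioc_union_Ioi_eq_Ioi zero_le_one]
  refine ⟨i1.union i2, ?_⟩
  rw [setIntegral_union (Ioc_disjoint_Ioi le_rfl) measurableSet_Ioi i1 i2,
    setIntegral_congr_fun measurableSet_Ioc e1, setIntegral_congr_fun measurableSet_Ioi e2,
    integral_Ioi_rpow_of_lt (by linarith) one_pos]
  have h1 : (n : ℝ) - 1 ≠ 0 := by linarith
  have h2 : -(n : ℝ) + 1 ≠ 0 := by linarith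
  simp
  field_simp
  ring

/-- The contribution `ε / t` of a point at distance `t < ε`; it is `0` at distance `t ≥ ε`, and also
at distance `t = 0`, as a division by zero. -/
def thresholdRatio (ε : ℝ) (t : ℝ≥0∞) : ℝ := if t < ENNReal.ofReal ε then ε / t.toReal else 0

theorem measurable_thresholdRatio (ε : ℝ) : Measurable (thresholdRatio ε) := by
  unfold thresholdRatio
  exact Measurable.ite measurableSet_Iio (by fun_prop) measurable_const

theorem thresholdRatio_nonneg {ε : ℝ} (hε : 0 ≤ ε) (t : ℝ≥0∞) : 0 ≤ thresholdRatio ε t := by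
  unfold thresholdRatio
  split_ifs <;> positivity

theorem lt_thresholdRatio_iff {ε s : ℝ} (hε : 0 < ε) (hs : 0 < s) (t : ℝ≥0∞) :
    s < thresholdRatio ε t ↔ t < ENNReal.ofReal (ε / max 1 s) ∧ t ≠ 0 := by
  unfold thresholdRatio
  rcases eq_or_ne t 0 with rfl | h0
  · simp [hs.le]
  rcases eq_or_ne t ⊤ with rfl | htop
  · simp [hs.le]
  have hpos : 0 < t.toReal := ENNReal.toReal_pos h0 htop
  have hm : 0 < max 1 s := lt_max_of_lt_left one_pos
  have key (a : ℝ) : t < ENNReal.ofReal a ↔ t.toReal < a := ENNReal.lt_ofReal_iff_toReal_lt htop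
  simp only [key, h0, ne_eq, not_false_eq_true, and_true]
  rw [lt_div_iff₀ hm]
  split_ifs with h
  · rw [lt_div_iff₀ hpos]
    rcases le_total 1 s with h1 | h1
    · rw [max_eq_right h1, mul_comm]
    · rw [max_eq_left h1, mul_one]
      refine ⟨fun _ ↦ h, fun _ ↦ ?_⟩
      nlinarith
  · refine ⟨fun h' ↦ absurd h' (not_lt.2 hs.le), fun h' ↦ absurd ?_ h⟩
    nlinarith [le_max_left 1 s]

variable {Ω : Type*} [MeasurableSpace Ω] {μ : Measure Ω} [IsProbabilityMeasure μ]
  {u : Ω → ℝ≥0∞} {n : ℕ} {c : ℝ}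

theorem measure_eq_zero_of_tendsto_div_pow (hn : 2 ≤ n)
    (h : Tendsto (fun ρ : ℝ ↦ μ.real {y | u y < ENNReal.ofReal ρ} / ρ ^ n) (𝓝[>] 0) (𝓝 c)) :
    μ {y | u y = 0} = 0 := by
  have h1 : Tendsto (fun ρ : ℝ ↦ μ.real {y | u y < ENNReal.ofReal ρ} / ρ ^ n * ρ ^ n) (𝓝[>] 0)
      (𝓝 0) := by
    have h2 : Tendsto (fun ρ : ℝ ↦ ρ ^ n) (𝓝[>] 0) (𝓝 0) := by
      have := (continuous_pow (M := ℝ) n).tendsto 0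
      rw [zero_pow (by omega)] at this
      exact this.mono_left nhdsWithin_le_nhds
    simpa using h.mul h2
  have h3 : μ.real {y | u y = 0} ≤ 0 := by
    refine ge_of_tendsto h1 ?_
    filter_upwards [self_mem_nhdsWithin] with ρ hρ
    have hρ : 0 < ρ := hρ
    rw [div_mul_cancel₀ _ (by positivity)]
    refine measureReal_mono fun y hy ↦ ?_
    have hy : u y = 0 := hy
    simp [hy, hρ]
  exact (measureReal_eq_zero_iff).1 (le_antisymm h3 measureReal_nonneg)

theorem measureReal_lt_thresholdRatio (hn : 2 ≤ n)
    (h : Tendsto (fun ρ : ℝ ↦ μ.real {y | u y < ENNReal.ofReal ρ} / ρ ^ n) (𝓝[>] 0) (𝓝 c))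
    {ε s : ℝ} (hε : 0 < ε) (hs : 0 < s) :
    μ.real {y | s < thresholdRatio ε (u y)} =
      μ.real {y | u y < ENNReal.ofReal (ε / max 1 s)} := by
  have e : {y | s < thresholdRatio ε (u y)} =
      {y | u y < ENNReal.ofReal (ε / max 1 s)} \ {y | u y = 0} := by
    ext y
    exact lt_thresholdRatio_iff hε hs (u y)
  rw [e, Measure.real, Measure.real, measure_sdiff_null (measure_eq_zero_of_tendsto_div_pow hn h)]

/-- If `μ {u < ρ} ∼ c ρⁿ`, then the mean of `ε / u` over `{u < ε}` is asymptotic to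
`c (n / (n - 1)) εⁿ`, and truncating `ε / u` at a level that tends to infinity (which is the purpose
of `g`) does not change this. By the layer cake formula, the mean is the integral over `s > 0` of
`μ {u < ε / max 1 s} ∼ c εⁿ (max 1 s)⁻ⁿ`, and this is dominated convergence. -/
theorem tendsto_integral_thresholdRatio_div_pow (hn : 2 ≤ n)
    (h : Tendsto (fun ρ : ℝ ↦ μ.real {y | u y < ENNReal.ofReal ρ} / ρ ^ n) (𝓝[>] 0) (𝓝 c))
    {ε : ℕ → ℝ} (hε : Tendsto ε atTop (𝓝[>] 0)) {g : ℕ → Ω → ℝ} (hg : ∀ N, Measurable (g N))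
    (hg0 : ∀ N y, 0 ≤ g N y) (hle : ∀ N y, g N y ≤ thresholdRatio (ε N) (u y))
    (hev : ∀ s, ∀ᶠ N in atTop, ∀ y, s < thresholdRatio (ε N) (u y) → s < g N y) :
    (∀ᶠ N in atTop, Integrable (g N) μ) ∧
      Tendsto (fun N ↦ (∫ y, g N y ∂μ) / ε N ^ n) atTop (𝓝 (c * (n / (n - 1)))) := by
  obtain ⟨hGi, hG⟩ := integrableOn_inv_max_one_pow hn
  have hεpos : ∀ᶠ N in atTop, 0 < ε N := hε.eventually self_mem_nhdsWithin
  obtain ⟨ρ₀, hρ₀, hb⟩ : ∃ ρ₀ > 0, ∀ ρ, 0 < ρ → ρ < ρ₀ →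
      μ.real {y | u y < ENNReal.ofReal ρ} ≤ (c + 1) * ρ ^ n := by
    have := h.eventually (gt_mem_nhds (lt_add_one c))
    obtain ⟨ρ₀, hρ₀, hsub⟩ := mem_nhdsGT_iff_exists_Ioo_subset.1 this
    refine ⟨ρ₀, hρ₀, fun ρ h1 h2 ↦ ?_⟩
    have h3 : μ.real {y | u y < ENNReal.ofReal ρ} / ρ ^ n < c + 1 := hsub ⟨h1, h2⟩
    rw [div_lt_iff₀ (by positivity)] at h3
    exact h3.le
  have hsmall : ∀ᶠ N in atTop, ε N < ρ₀ :=
    (hε.mono_right nhdsWithin_le_nhds).eventually (gt_mem_nhds hρ₀)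
  -- the tails of `g N` are dominated by an integrable function
  have hdom : ∀ᶠ N in atTop, 0 < ε N ∧ ∀ s, 0 < s →
      μ.real {y | s < g N y} ≤ ε N ^ n * ((c + 1) * ((max 1 s) ^ n)⁻¹) := by
    filter_upwards [hεpos, hsmall] with N hN hN'
    refine ⟨hN, fun s hs ↦ ?_⟩
    have hm : 1 ≤ max 1 s := le_max_left _ _
    calc μ.real {y | s < g N y} ≤ μ.real {y | s < thresholdRatio (ε N) (u y)} :=
          measureReal_mono fun y hy ↦ lt_of_lt_of_le hy (hle N y)
      _ ≤ (c + 1) * (ε N / max 1 s) ^ n := by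
          rw [measureReal_lt_thresholdRatio hn h hN hs]
          exact hb _ (by positivity) ((div_le_self hN.le hm).trans_lt hN')
      _ = _ := by rw [div_pow]; ring
  have hint : ∀ᶠ N in atTop, Integrable (g N) μ := by
    filter_upwards [hdom] with N ⟨hN, hN'⟩
    refine ⟨(hg N).aestronglyMeasurable, ?_⟩
    rw [hasFiniteIntegral_iff_ofReal (Eventually.of_forall (hg0 N)),
      lintegral_eq_lintegral_meas_lt μ (Eventually.of_forall (hg0 N)) (hg N).aemeasurable]
    have hi : IntegrableOn (fun s : ℝ ↦ ε N ^ n * ((c + 1) * ((max 1 s) ^ n)⁻¹)) (Ioi 0) :=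
      (hGi.const_mul _).const_mul _
    refine lt_of_le_of_lt (setLIntegral_mono' measurableSet_Ioi fun s hs ↦ ?_)
      hi.lintegral_lt_top
    rw [← ofReal_measureReal]
    exact ENNReal.ofReal_le_ofReal (hN' s hs)
  refine ⟨hint, ?_⟩
  have hlim : Tendsto (fun N ↦ ∫ s in Ioi (0 : ℝ), μ.real {y | s < g N y} / ε N ^ n) atTop
      (𝓝 (∫ s in Ioi (0 : ℝ), c * ((max 1 s) ^ n)⁻¹)) := by
    refine tendsto_integral_filter_of_dominated_convergence
      (fun s ↦ (c + 1) * ((max 1 s) ^ n)⁻¹) ?_ ?_ (hGi.const_mul _) ?_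
    · refine Eventually.of_forall fun N ↦ ?_
      have : Antitone fun s ↦ μ.real {y | s < g N y} := fun s t hst ↦
        measureReal_mono fun y hy ↦ lt_of_le_of_lt hst hy
      exact (this.measurable.div_const _).aestronglyMeasurable
    · filter_upwards [hdom] with N ⟨hN, hN'⟩
      filter_upwards [ae_restrict_mem measurableSet_Ioi] with s hs
      rw [Real.norm_of_nonneg (by positivity), div_le_iff₀ (by positivity), mul_comm]
      exact hN' s hs
    · filter_upwards [ae_restrict_mem measurableSet_Ioi] with s hs
      have hs : 0 < s := hs
      have hm : 0 < max 1 s := lt_max_of_lt_left one_pos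
      have h1 : Tendsto (fun N ↦ ε N / max 1 s) atTop (𝓝[>] 0) := by
        refine tendsto_nhdsWithin_iff.2 ⟨?_, ?_⟩
        · simpa using (hε.mono_right nhdsWithin_le_nhds).div_const (max 1 s)
        · filter_upwards [hεpos] with N hN using div_pos hN hm
      refine ((h.comp h1).mul_const ((max 1 s) ^ n)⁻¹).congr' ?_
      filter_upwards [hεpos, hev s] with N hN hN'
      have e : {y | s < g N y} = {y | s < thresholdRatio (ε N) (u y)} := by
        ext y
        exact ⟨fun hy ↦ lt_of_lt_of_le hy (hle N y), hN' y⟩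
      rw [e, measureReal_lt_thresholdRatio hn h hN hs]
      simp only [Function.comp_apply, div_pow]
      field_simp
  rw [integral_const_mul, hG] at hlim
  refine hlim.congr' ?_
  filter_upwards [hint] with N hN
  rw [integral_div, hN.integral_eq_integral_meas_lt (Eventually.of_forall (hg0 N))]

end FirstMoment

/-! ### A weak law of large numbers for triangular arrays -/

section LawOfLargeNumbers

variable {Ω : Type*} [MeasurableSpace Ω] {μ : Measure Ω} [IsProbabilityMeasure μ]

theorem integral_pi_sum {m : ℕ} {f : Ω → ℝ} (hf : Integrable f μ) :
    ∫ y, ∑ j, f (y j) ∂(Measure.pi fun _ : Fin m ↦ μ) = m * ∫ y, f y ∂μ := by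
  rw [integral_finsetSum _ fun j _ ↦ integrable_comp_eval (μ := fun _ : Fin m ↦ μ) (i := j) hf]
  simp_rw [integral_comp_eval (μ := fun _ : Fin m ↦ μ) hf.aestronglyMeasurable]
  simp

/-- Markov's inequality for a sum of independent copies of `f ≥ 0`. -/
theorem measure_pi_le_markov {m : ℕ} {f : Ω → ℝ} (hf : Integrable f μ) (h0 : ∀ y, 0 ≤ f y)
    {a : ℝ} (ha : 0 < a) :
    (Measure.pi fun _ : Fin m ↦ μ) {y | a ≤ ∑ j, f (y j)} ≤
      ENNReal.ofReal (m * (∫ y, f y ∂μ) / a) := by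
  have h := mul_meas_ge_le_integral_of_nonneg (μ := Measure.pi fun _ : Fin m ↦ μ)
    (f := fun y ↦ ∑ j, f (y j)) (Eventually.of_forall fun y ↦ Finset.sum_nonneg fun j _ ↦ h0 _)
    (integrable_finsetSum _ fun j _ ↦ integrable_comp_eval (μ := fun _ : Fin m ↦ μ) (i := j) hf) a
  rw [integral_pi_sum hf] at h
  rw [← ofReal_measureReal]
  exact ENNReal.ofReal_le_ofReal ((le_div_iff₀' ha).2 h)

/-- Chebyshev's inequality for a sum of independent copies of `g`, where `0 ≤ g ≤ K`, with the
variance of `g` bounded by `K` times its mean. -/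
theorem measure_pi_le_chebyshev {m : ℕ} {g : Ω → ℝ} (hg : Measurable g) (h0 : ∀ y, 0 ≤ g y)
    {K : ℝ} (hK : ∀ y, g y ≤ K) {a : ℝ} (ha : 0 < a) :
    (Measure.pi fun _ : Fin m ↦ μ) {y | a ≤ |∑ j, g (y j) - m * ∫ y, g y ∂μ|} ≤
      ENNReal.ofReal (K * (m * ∫ y, g y ∂μ) / a ^ 2) := by
  have hbd : ∀ y, ‖g y‖ ≤ K := fun y ↦ by rw [Real.norm_of_nonneg (h0 y)]; exact hK y
  have hL (p : ℝ≥0∞) : MemLp g p μ :=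
    MemLp.of_bound hg.aestronglyMeasurable K (Eventually.of_forall hbd)
  have hi : Integrable g μ := memLp_one_iff_integrable.1 (hL 1)
  have hsum : (fun y : Fin m → Ω ↦ ∑ j, g (y j)) = ∑ j, fun y : Fin m → Ω ↦ g (y j) := by
    ext y; simp
  have hLs : MemLp (fun y : Fin m → Ω ↦ ∑ j, g (y j)) 2 (Measure.pi fun _ : Fin m ↦ μ) :=
    memLp_finsetSum _ fun j _ ↦ (hL 2).comp_measurePreserving
      (measurePreserving_eval (fun _ : Fin m ↦ μ) j)
  have h := meas_ge_le_variance_div_sq hLs ha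
  rw [integral_pi_sum hi] at h
  refine h.trans (ENNReal.ofReal_le_ofReal ?_)
  gcongr
  have hvar : Var[g; μ] ≤ K * ∫ y, g y ∂μ := by
    refine (variance_le_expectation_sq hg.aestronglyMeasurable).trans ?_
    rw [← integral_const_mul]
    refine integral_mono ?_ (hi.const_mul K) fun y ↦ ?_
    · exact (hL 2).integrable_sq
    · simp only [Pi.pow_apply, sq]
      exact mul_le_mul_of_nonneg_right (hK y) (h0 y)
  rw [hsum, variance_sum_pi (μ := fun _ : Fin m ↦ μ) (X := fun _ ↦ g) fun _ ↦ hL 2]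
  simp only [Finset.sum_const, Finset.card_univ, Fintype.card_fin, nsmul_eq_mul]
  calc m * Var[g; μ] ≤ m * (K * ∫ y, g y ∂μ) := by gcongr
    _ = _ := by ring

/-- A weak law of large numbers for a triangular array, under first moment conditions only: truncate
the `N`-th row at `√(b N)`, use Markov's inequality for the part above the truncation and
Chebyshev's inequality for the part below. -/
theorem tendsto_measure_pi_lt_abs_sum_div_sub {f : ℕ → Ω → ℝ} (hf : ∀ N, Measurable (f N))
    (h0 : ∀ N y, 0 ≤ f N y) (hint : ∀ᶠ N in atTop, Integrable (f N) μ) {m : ℕ → ℕ} {b : ℕ → ℝ}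
    {l : ℝ} (hb : Tendsto b atTop atTop)
    (h1 : Tendsto (fun N ↦ m N * (∫ y, f N y ∂μ) / b N) atTop (𝓝 l))
    (h2 : Tendsto (fun N ↦ m N * (∫ y, min (f N y) (√(b N)) ∂μ) / b N) atTop (𝓝 l))
    {η : ℝ} (hη : 0 < η) :
    Tendsto (fun N ↦ (Measure.pi fun _ : Fin (m N) ↦ μ)
      {y | η < |(∑ j, f N (y j)) / b N - l|}) atTop (𝓝 0) := by
  have hmarkov : Tendsto (fun N ↦ (3 / η) * (m N * (∫ y, f N y ∂μ) / b N -
      m N * (∫ y, min (f N y) (√(b N)) ∂μ) / b N)) atTop (𝓝 0) := by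
    simpa using (h1.sub h2).const_mul (3 / η)
  have hcheb : Tendsto (fun N ↦ (9 / η ^ 2) * ((m N * (∫ y, min (f N y) (√(b N)) ∂μ) / b N) *
      (√(b N))⁻¹)) atTop (𝓝 0) := by
    have : Tendsto (fun N ↦ (√(b N))⁻¹) atTop (𝓝 0) :=
      tendsto_inv_atTop_zero.comp (Real.tendsto_sqrt_atTop.comp hb)
    simpa using (h2.mul this).const_mul (9 / η ^ 2)
  have hsum := (ENNReal.tendsto_ofReal hmarkov).add (ENNReal.tendsto_ofReal hcheb)
  simp only [ENNReal.ofReal_zero, add_zero] at hsum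
  refine tendsto_of_tendsto_of_tendsto_of_le_of_le' tendsto_const_nhds hsum
    (Eventually.of_forall fun _ ↦ zero_le) ?_
  have hclose : ∀ᶠ N in atTop, |m N * (∫ y, min (f N y) (√(b N)) ∂μ) / b N - l| < η / 3 := by
    have := h2.eventually (Metric.ball_mem_nhds l (show 0 < η / 3 by positivity))
    filter_upwards [this] with N hN
    rwa [Real.dist_eq] at hN
  filter_upwards [hint, hb.eventually_gt_atTop 0, hclose] with N hN hbN hcN
  set g : Ω → ℝ := fun y ↦ min (f N y) (√(b N)) with hg
  have hgm : Measurable g := (hf N).min measurable_const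
  have hg0 : ∀ y, 0 ≤ g y := fun y ↦ le_min (h0 N y) (Real.sqrt_nonneg _)
  have hgi : Integrable g μ := hN.mono hgm.aestronglyMeasurable (Eventually.of_forall fun y ↦ by
    rw [Real.norm_of_nonneg (hg0 y), Real.norm_of_nonneg (h0 N y)]; exact min_le_left _ _)
  have hM := measure_pi_le_markov (μ := μ) (m := m N) (f := fun y ↦ f N y - g y) (hN.sub hgi)
    (fun y ↦ sub_nonneg.2 (min_le_left _ _)) (show 0 < η / 3 * b N by positivity)
  have hC := measure_pi_le_chebyshev (μ := μ) (m := m N) hgm hg0 (fun y ↦ min_le_right _ _)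
    (show 0 < η / 3 * b N by positivity)
  -- if the normalized sum of `f` is `η`-far from `l`, then either the truncation has changed it by
  -- `η / 3`, or the truncated sum is `η / 3`-far from its mean, which is `η / 3`-close to `l`
  refine (measure_mono (fun y hy ↦ ?_)).trans ((measure_union_le _ _).trans (add_le_add
    (hM.trans (ENNReal.ofReal_le_ofReal (le_of_eq ?_)))
    (hC.trans (ENNReal.ofReal_le_ofReal (le_of_eq ?_)))))
  · by_contra hcon
    simp only [mem_union, mem_ofPred_eq, not_or, not_le, Finset.sum_sub_distrib] at hcon hy
    obtain ⟨hA, hB⟩ := hcon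
    have hA' : (∑ j, f N (y j)) / b N - (∑ j, g (y j)) / b N < η / 3 := by
      rw [← sub_div, div_lt_iff₀ hbN]; exact hA
    have hA0 : 0 ≤ (∑ j, f N (y j)) / b N - (∑ j, g (y j)) / b N := by
      rw [← sub_div]
      refine div_nonneg (sub_nonneg.2 (Finset.sum_le_sum fun j _ ↦ min_le_left _ _)) hbN.le
    have hB' : |(∑ j, g (y j)) / b N - m N * (∫ y, g y ∂μ) / b N| < η / 3 := by
      rw [← sub_div, abs_div, abs_of_pos hbN, div_lt_iff₀ hbN]; exact hB
    rw [abs_lt] at hB' hcN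
    refine absurd hy (not_lt.2 (abs_le.2 ⟨?_, ?_⟩)) <;> linarith [hB'.1, hB'.2, hcN.1, hcN.2]
  · rw [integral_sub hN hgi]
    field_simp
  · have hs : √(b N) ^ 2 = b N := Real.sq_sqrt hbN.le
    have hs0 : √(b N) ≠ 0 := (Real.sqrt_pos.2 hbN).ne'
    field_simp
    rw [hs]
    ring

end LawOfLargeNumbers

/-! ### Random geometric graphs -/

section FixedCenter

/-- The number (`0` or `1`) of neighbors contributed by a point at distance `t`. -/
def thresholdCount (ε : ℝ) (t : ℝ≥0∞) : ℝ := if t < ENNReal.ofReal ε then 1 else 0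

theorem measurable_thresholdCount (ε : ℝ) : Measurable (thresholdCount ε) := by
  unfold thresholdCount
  exact Measurable.ite measurableSet_Iio measurable_const measurable_const

variable {Ω : Type*} [MeasurableSpace Ω] {μ : Measure Ω} [IsProbabilityMeasure μ]
  {u : Ω → ℝ≥0∞} {n : ℕ} {c : ℝ} {ε : ℕ → ℝ} {m : ℕ → ℕ}

theorem tendsto_measure_pi_sum_thresholdCount (hu : Measurable u)
    (h : Tendsto (fun ρ : ℝ ↦ μ.real {y | u y < ENNReal.ofReal ρ} / ρ ^ n) (𝓝[>] 0) (𝓝 c))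
    (hε : Tendsto ε atTop (𝓝[>] 0)) (hm : Tendsto (fun N ↦ m N * ε N ^ n) atTop atTop)
    {η : ℝ} (hη : 0 < η) :
    Tendsto (fun N ↦ (Measure.pi fun _ : Fin (m N) ↦ μ)
      {y | η < |(∑ j, thresholdCount (ε N) (u (y j))) / (m N * ε N ^ n) - c|}) atTop (𝓝 0) := by
  have hmeas (N : ℕ) : Measurable fun y ↦ thresholdCount (ε N) (u y) :=
    (measurable_thresholdCount _).comp hu
  have h01 (N : ℕ) (y : Ω) : 0 ≤ thresholdCount (ε N) (u y) ∧
      thresholdCount (ε N) (u y) ≤ 1 := by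
    unfold thresholdCount; split_ifs <;> simp
  have hint (N : ℕ) : ∫ y, thresholdCount (ε N) (u y) ∂μ =
      μ.real {y | u y < ENNReal.ofReal (ε N)} := by
    have hs : MeasurableSet {y | u y < ENNReal.ofReal (ε N)} := measurableSet_lt hu measurable_const
    rw [← integral_indicator_one hs]
    exact integral_congr_ae (Eventually.of_forall fun y ↦ by
      simp [thresholdCount, indicator_apply])
  have h1 : Tendsto (fun N ↦ m N * (∫ y, thresholdCount (ε N) (u y) ∂μ) / (m N * ε N ^ n)) atTop
      (𝓝 c) := by
    refine (h.comp hε).congr' ?_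
    filter_upwards [hm.eventually_gt_atTop 0] with N hN
    have hmN : (m N : ℝ) ≠ 0 := fun h0 ↦ by simp [h0] at hN
    rw [hint, mul_div_mul_left _ _ hmN]
    rfl
  refine tendsto_measure_pi_lt_abs_sum_div_sub hmeas (fun N y ↦ (h01 N y).1)
    (Eventually.of_forall fun N ↦ ?_) hm h1 (h1.congr' ?_) hη
  · refine Integrable.of_bound (hmeas N).aestronglyMeasurable 1 (Eventually.of_forall fun y ↦ ?_)
    rw [Real.norm_of_nonneg (h01 N y).1]; exact (h01 N y).2
  · filter_upwards [hm.eventually_ge_atTop 1] with N hN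
    have : ∀ y, min (thresholdCount (ε N) (u y)) (√(m N * ε N ^ n)) =
        thresholdCount (ε N) (u y) := fun y ↦
      min_eq_left ((h01 N y).2.trans (Real.one_le_sqrt.2 hN))
    simp only [this]

theorem tendsto_measure_pi_sum_thresholdRatio (hn : 2 ≤ n) (hu : Measurable u)
    (h : Tendsto (fun ρ : ℝ ↦ μ.real {y | u y < ENNReal.ofReal ρ} / ρ ^ n) (𝓝[>] 0) (𝓝 c))
    (hε0 : ∀ N, 0 ≤ ε N) (hε : Tendsto ε atTop (𝓝[>] 0))
    (hm : Tendsto (fun N ↦ m N * ε N ^ n) atTop atTop) {η : ℝ} (hη : 0 < η) :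
    Tendsto (fun N ↦ (Measure.pi fun _ : Fin (m N) ↦ μ)
      {y | η < |(∑ j, thresholdRatio (ε N) (u (y j))) / (m N * ε N ^ n) - c * (n / (n - 1))|})
      atTop (𝓝 0) := by
  have hmeas (N : ℕ) : Measurable fun y ↦ thresholdRatio (ε N) (u y) :=
    (measurable_thresholdRatio _).comp hu
  have h0 (N : ℕ) (y : Ω) : 0 ≤ thresholdRatio (ε N) (u y) := thresholdRatio_nonneg (hε0 N) _
  have hmN : ∀ᶠ N in atTop, (m N : ℝ) ≠ 0 := by
    filter_upwards [hm.eventually_gt_atTop 0] with N hN h0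
    simp [h0] at hN
  obtain ⟨hi, h1⟩ := tendsto_integral_thresholdRatio_div_pow hn h hε hmeas h0
    (fun N y ↦ le_rfl) (fun s ↦ Eventually.of_forall fun N y hy ↦ hy)
  obtain ⟨-, h2⟩ := tendsto_integral_thresholdRatio_div_pow hn h hε
    (g := fun N y ↦ min (thresholdRatio (ε N) (u y)) (√(m N * ε N ^ n)))
    (fun N ↦ (hmeas N).min measurable_const) (fun N y ↦ le_min (h0 N y) (Real.sqrt_nonneg _))
    (fun N y ↦ min_le_left _ _) (fun s ↦ by
      filter_upwards [(Real.tendsto_sqrt_atTop.comp hm).eventually_gt_atTop s] with N hN y hy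
      exact lt_min hy hN)
  refine tendsto_measure_pi_lt_abs_sum_div_sub hmeas h0 hi hm (h1.congr' ?_) (h2.congr' ?_) hη
  · filter_upwards [hmN] with N hN using (mul_div_mul_left _ _ hN).symm
  · filter_upwards [hmN] with N hN using (mul_div_mul_left _ _ hN).symm

/-- For a fixed center, the average of `ε / d` over the sample points at distance `d < ε` of the
center converges in probability: the sum of `ε / d` and the number of these points are both
concentrated, and the normalizations cancel in the quotient. -/
theorem tendsto_measure_pi_average (hn : 2 ≤ n) (hu : Measurable u) (hc : 0 < c)
    (h : Tendsto (fun ρ : ℝ ↦ μ.real {y | u y < ENNReal.ofReal ρ} / ρ ^ n) (𝓝[>] 0) (𝓝 c))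
    (hε0 : ∀ N, 0 ≤ ε N) (hε : Tendsto ε atTop (𝓝[>] 0))
    (hm : Tendsto (fun N ↦ m N * ε N ^ n) atTop atTop) {η : ℝ} (hη : 0 < η) :
    Tendsto (fun N ↦ (Measure.pi fun _ : Fin (m N) ↦ μ)
      {y | η < |(∑ j, thresholdRatio (ε N) (u (y j))) / (∑ j, thresholdCount (ε N) (u (y j))) -
        n / (n - 1)|}) atTop (𝓝 0) := by
  obtain ⟨δ, hδ, hδη⟩ : ∃ δ > 0, ∀ s d : ℝ, |s - c * (n / (n - 1))| ≤ δ → |d - c| ≤ δ →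
      |s / d - n / (n - 1)| ≤ η := by
    have hcont : ContinuousAt (fun z : ℝ × ℝ ↦ z.1 / z.2) (c * (n / (n - 1)), c) :=
      continuousAt_fst.div continuousAt_snd hc.ne'
    obtain ⟨δ, hδ, hδ'⟩ := Metric.continuousAt_iff.1 hcont η hη
    refine ⟨δ / 2, by positivity, fun s d hs hd ↦ ?_⟩
    have := hδ' (x := (s, d)) (by
      rw [Prod.dist_eq, Real.dist_eq, Real.dist_eq]
      exact max_lt (by linarith) (by linarith))
    rw [Real.dist_eq, mul_div_cancel_left₀ _ hc.ne'] at this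
    exact this.le
  have hS := tendsto_measure_pi_sum_thresholdRatio hn hu h hε0 hε hm hδ
  have hD := tendsto_measure_pi_sum_thresholdCount hu h hε hm hδ
  have hSD := hS.add hD
  rw [add_zero] at hSD
  refine tendsto_of_tendsto_of_tendsto_of_le_of_le' tendsto_const_nhds hSD
    (Eventually.of_forall fun _ ↦ zero_le) ?_
  filter_upwards [hm.eventually_gt_atTop 0] with N hN
  refine (measure_mono fun y hy ↦ ?_).trans (measure_union_le _ _)
  by_contra hcon
  simp only [mem_union, mem_ofPred_eq, not_or, not_lt] at hcon hy
  have := hδη _ _ hcon.1 hcon.2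
  rw [div_div_div_cancel_right₀ hN.ne'] at this
  linarith

end FixedCenter

section Assembly

variable {M : Type*} [EMetricSpace M]

theorem meanRatio_eq_sum_div_sum {m : ℕ} (ε : ℝ) (p : Fin (m + 1) → M) (i : Fin (m + 1)) :
    meanRatio ε p i = (∑ j, thresholdRatio ε (edist (p i) (p (i.succAbove j)))) /
      ∑ j, thresholdCount ε (edist (p i) (p (i.succAbove j))) := by
  classical
  have hadj (j : Fin m) : (geometricGraph ε p).Adj i (i.succAbove j) ↔
      edist (p i) (p (i.succAbove j)) < ENNReal.ofReal ε :=
    and_iff_right (Fin.succAbove_ne i j).symm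
  have hsum (w : Fin (m + 1) → ℝ) : ∑ j ∈ (geometricGraph ε p).neighborFinset i, w j =
      ∑ j, if edist (p i) (p (i.succAbove j)) < ENNReal.ofReal ε then w (i.succAbove j) else 0 := by
    rw [SimpleGraph.neighborFinset_eq_filter, Finset.sum_filter, Fin.sum_univ_succAbove _ i]
    simp [hadj]
  have hdeg : ((geometricGraph ε p).degree i : ℝ) =
      ∑ j ∈ (geometricGraph ε p).neighborFinset i, (1 : ℝ) := by
    simp
  unfold meanRatio
  rw [hsum, hdeg]
  congr 1
  convert hsum _
  simp only [thresholdCount]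

variable [SecondCountableTopology M] [MeasurableSpace M] [BorelSpace M]

/-- The average of `ε / d(x, y)` over the points `y = p j` at distance less than `ε` from `x`. -/
def centeredRatio {m : ℕ} (ε : ℝ) (z : M × (Fin m → M)) : ℝ :=
  (∑ j, thresholdRatio ε (edist z.1 (z.2 j))) / ∑ j, thresholdCount ε (edist z.1 (z.2 j))

theorem measurable_centeredRatio {m : ℕ} (ε : ℝ) :
    Measurable (centeredRatio (M := M) (m := m) ε) := by
  have h (j : Fin m) : Measurable fun z : M × (Fin m → M) ↦ edist z.1 (z.2 j) :=
    measurable_fst.edist ((measurable_pi_apply j).comp measurable_snd)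
  refine Measurable.div ?_ ?_
  · exact Finset.measurable_fun_sum _ fun j _ ↦ (measurable_thresholdRatio ε).comp (h j)
  · exact Finset.measurable_fun_sum _ fun j _ ↦ (measurable_thresholdCount ε).comp (h j)

/-- All nodes play the same role, so the law of the average ratio at a random node is that of the
average ratio at a first random point `x` among further independent points. -/
theorem pi_prod_uniformOn_meanRatio (μ : Measure M) [IsProbabilityMeasure μ] {m : ℕ} (ε η l : ℝ) :
    ((Measure.pi fun _ : Fin (m + 1) ↦ μ).prod (uniformOn (univ : Set (Fin (m + 1)))))
      {s | η < |meanRatio ε s.1 s.2 - l|} =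
    ∫⁻ x, (Measure.pi fun _ : Fin m ↦ μ) {y | η < |centeredRatio ε (x, y) - l|} ∂μ := by
  have hB : MeasurableSet {z : M × (Fin m → M) | η < |centeredRatio ε z - l|} :=
    measurableSet_lt measurable_const ((measurable_centeredRatio ε).sub_const l).abs
  have hpre (i : Fin (m + 1)) : {p : Fin (m + 1) → M | η < |meanRatio ε p i - l|} =
      MeasurableEquiv.piFinSuccAbove (fun _ ↦ M) i ⁻¹'
        {z : M × (Fin m → M) | η < |centeredRatio ε z - l|} := by
    ext p
    simp only [mem_ofPred_eq, mem_preimage, meanRatio_eq_sum_div_sum]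
    rfl
  have hi (i : Fin (m + 1)) : (Measure.pi fun _ : Fin (m + 1) ↦ μ)
      {p | η < |meanRatio ε p i - l|} =
      ∫⁻ x, (Measure.pi fun _ : Fin m ↦ μ) {y | η < |centeredRatio ε (x, y) - l|} ∂μ := by
    rw [hpre, (measurePreserving_piFinSuccAbove (fun _ : Fin (m + 1) ↦ μ) i).measure_preimage
      hB.nullMeasurableSet, Measure.prod_apply hB]
    rfl
  have hS : MeasurableSet {s : (Fin (m + 1) → M) × Fin (m + 1) | η < |meanRatio ε s.1 s.2 - l|} := by
    refine measurableSet_lt measurable_const (Measurable.abs (Measurable.sub_const ?_ l))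
    refine measurable_from_prod_countable_left fun i ↦ ?_
    have : (fun p : Fin (m + 1) → M ↦ meanRatio ε p i) =
        centeredRatio ε ∘ MeasurableEquiv.piFinSuccAbove (fun _ ↦ M) i := by
      ext p; exact meanRatio_eq_sum_div_sum ε p i
    simp only [this]
    exact (measurable_centeredRatio ε).comp (MeasurableEquiv.measurable _)
  have : IsProbabilityMeasure (uniformOn (univ : Set (Fin (m + 1)))) :=
    isProbabilityMeasure_uniformOn finite_univ univ_nonempty
  rw [Measure.prod_apply_symm hS]
  refine (lintegral_congr fun i ↦ hi i).trans ?_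
  simp

/-- Convergence in probability of the average ratio at a random node, for independent points with a
law `μ` such that `μ (B(x, ρ)) ∼ c ρⁿ` for every `x`, where `c` may depend on `x`. -/
theorem convergesInProbability_meanRatio (μ : Measure M) [IsProbabilityMeasure μ] {n : ℕ}
    (hn : 2 ≤ n) (h : ∀ x, ∃ c : ℝ, 0 < c ∧ Tendsto (fun ρ : ℝ ↦
      μ.real {y | edist x y < ENNReal.ofReal ρ} / ρ ^ n) (𝓝[>] 0) (𝓝 c))
    {ε : ℕ → ℝ} (hε0 : ∀ N, 0 ≤ ε N) (hε : Tendsto ε atTop (𝓝[>] 0))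
    (hm : Tendsto (fun N ↦ N * ε N ^ n) atTop atTop) :
    ConvergesInProbability
      (fun N ↦ (Measure.pi fun _ : Fin N ↦ μ).prod (uniformOn (univ : Set (Fin N))))
      (fun N s ↦ meanRatio (ε N) s.1 s.2) ((n : ℝ) / ((n : ℝ) - 1)) := by
  intro η hη
  rw [← tendsto_add_atTop_iff_nat 1]
  simp only [pi_prod_uniformOn_meanRatio]
  have hε' : Tendsto (fun m ↦ ε (m + 1)) atTop (𝓝[>] 0) := hε.comp (tendsto_add_atTop_nat 1)
  have hm' : Tendsto (fun m : ℕ ↦ m * ε (m + 1) ^ n) atTop atTop := by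
    -- `m εⁿ` differs from `(m + 1) εⁿ` by `εⁿ`, which is bounded
    have h1 : Tendsto (fun m : ℕ ↦ ((m + 1 : ℕ) : ℝ) * ε (m + 1) ^ n) atTop atTop :=
      hm.comp (tendsto_add_atTop_nat 1)
    have h2 : Tendsto (fun m ↦ -ε (m + 1) ^ n) atTop (𝓝 (-0 ^ n)) :=
      ((hε'.mono_right nhdsWithin_le_nhds).pow n).neg
    refine (h1.atTop_add h2).congr fun m ↦ ?_
    push_cast
    ring
  have hlim : ∀ x, Tendsto (fun m : ℕ ↦ (Measure.pi fun _ : Fin m ↦ μ)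
      {y | η < |centeredRatio (ε (m + 1)) (x, y) - n / (n - 1)|}) atTop (𝓝 0) := by
    intro x
    obtain ⟨c, hc, hx⟩ := h x
    exact tendsto_measure_pi_average (u := fun y ↦ edist x y) hn (by fun_prop) hc hx
      (fun m ↦ hε0 (m + 1)) hε' hm' hη
  have := tendsto_lintegral_of_dominated_convergence (μ := μ) (f := fun _ ↦ 0)
    (F := fun m x ↦ (Measure.pi fun _ : Fin m ↦ μ)
      {y | η < |centeredRatio (ε (m + 1)) (x, y) - n / (n - 1)|}) (fun _ ↦ 1) (fun m ↦ ?_)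
    (fun m ↦ Eventually.of_forall fun x ↦ prob_le_one) (by simp)
    (Eventually.of_forall hlim)
  · simpa using this
  · exact measurable_measure_prodMk_left (measurableSet_lt measurable_const
      ((measurable_centeredRatio (m := m) (ε (m + 1))).sub_const _).abs)

end Assembly

theorem tendsto_natCast_mul_rpow_neg_pow {n : ℕ} {α : ℝ} (h : α * n < 1) :
    Tendsto (fun N : ℕ ↦ (N : ℝ) * ((N : ℝ) ^ (-α)) ^ n) atTop atTop := by
  have h1 : Tendsto (fun N : ℕ ↦ (N : ℝ) ^ (1 - α * n)) atTop atTop :=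
    (tendsto_rpow_atTop (by linarith)).comp tendsto_natCast_atTop_atTop
  refine h1.congr' ?_
  filter_upwards [eventually_gt_atTop 0] with N hN
  have hN' : (0 : ℝ) < N := by exact_mod_cast hN
  rw [← Real.rpow_natCast, ← Real.rpow_mul hN'.le, sub_eq_add_neg, Real.rpow_add hN',
    Real.rpow_one, neg_mul]

end

theorem mainTheorem5 (n : ℕ) (hn : 2 ≤ n)
    (M : Type*) [EMetricSpace M] [CompactSpace M] [Nonempty M]
    [ChartedSpace (EuclideanSpace ℝ (Fin n)) M] [IsManifold (𝓡 n) ∞ M]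
    [Bundle.RiemannianBundle (fun x : M ↦ TangentSpace (𝓡 n) x)]
    [IsContMDiffRiemannianBundle (𝓡 n) ∞ (EuclideanSpace ℝ (Fin n))
      (fun x : M ↦ TangentSpace (𝓡 n) x)]
    [IsRiemannianManifold (𝓡 n) M]
    [MeasurableSpace M] [BorelSpace M]
    (α : ℝ) (hα₀ : 0 < α) (hα₁ : α < 1 / (6 * (n : ℝ))) :
    ConvergesInProbability (fun N ↦ randomNodeLaw n M N)
      (fun N s ↦ meanRatio ((N : ℝ) ^ (-α)) s.1 s.2)
      ((n : ℝ) / ((n : ℝ) - 1)) := by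
  have := isProbabilityMeasure_uniformMeasure n M
  have hn' : (2 : ℝ) ≤ n := by exact_mod_cast hn
  refine convergesInProbability_meanRatio (uniformMeasure n M) hn
    exists_tendsto_uniformMeasure_ball_div_pow (fun N ↦ by positivity) ?_
    (tendsto_natCast_mul_rpow_neg_pow ?_)
  · refine tendsto_nhdsWithin_iff.2
      ⟨(tendsto_rpow_neg_atTop hα₀).comp tendsto_natCast_atTop_atTop, ?_⟩
    filter_upwards [eventually_gt_atTop 0] with N hN
    have hN' : (0 : ℝ) < N := by exact_mod_cast hN
    exact Real.rpow_pos_of_pos hN' _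
  · rw [lt_div_iff₀ (by positivity)] at hα₁
    nlinarith
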